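/- Let $(W,S)$ be a finite Coxeter system with length function $\ell$. For $I\subseteq S$ let $W_I$ be the parabolic subgroup generated by $I$, let $X_I=\{w\in W : \ell(ws)>\ell(w)\ \text{for all } s\in I\}$, let $x_I=\sum_{w\in X_I}w\in\mathbb{Q}W$, and let $1_{W_I}^W$ be the character of $W$ induced from the trivial character of $W_I$. Let $\Sigma W\subseteq\mathbb{Q}W$ be the Solomon descent algebra, the $\mathbb{Q}$-linear span of the elements $x_I$ $(I\subseteq S)$, which form a basis of it, and let $\Phi$ be the linear map from $\Sigma W$ to the class functions on $W$ with $\Phi(x_I)=1_{W_I}^W$ for all $I\subseteq S$. Functions on $W$ are extended linearly to $\mathbb{Q}W$, and $\langle f,g\rangle_W=\frac1{|W|}\sum_{w\in W}f(w)g(w)$. Let $\Lambda(W)$ be the set of Coxeter classes, i.e. of equivalence classes of subsets of $S$ under the relation $I\sim J$ if and only if $wIw^{-1}=J$ for some $w\in W$. A conjugacy class of $W_I$ is cuspidal if it does not meet $W_K$ for any $K\subsetneq I$. For $\lambda\in\Lambda(W)$, an element $w\in W$ is a $\lambda$-element if for some $I\in\lambda$ the conjugacy class $C(w)$ of $w$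 in $W$ contains a cuspidal conjugacy class of $W_I$ (equivalently, $C(w)\cap W_I$ is a cuspidal conjugacy class of $W_I$). Let $C(\lambda)$ be the set of $\lambda$-elements and $\xi_\lambda$ its characteristic function. A family of good idempotents is a family $(E_\lambda)_{\lambda\in\Lambda(W)}$ of idempotents of $\mathbb{Q}W$ with $E_\lambda\in\Sigma W$ and $\Phi(E_\lambda)=\xi_\lambda$ for all $\lambda\in\Lambda(W)$; given such a family, let $\chi_\lambda$ be the character of the action of $W$ by right multiplication on $E_\lambda\mathbb{Q}W$. **Theorem.** The following statements are equivalent: 1. $\Phi(x)(y)=\Phi(y)(x)$ for all $x,y\in\Sigma W$. 2. For every family of good idempotents $(E_\lambda)_{\lambda\in\Lambda(W)}$, every $I\subseteq S$ and every $\lambda\in\Lambda(W)$, $$|C(\lambda)\cap X_I|=\langle\chi_\lambda,1_{W_I}^W\rangle_W .$$ -/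

import Mathlib

noncomputable section

namespace CoxeterSystem

variable {B : Type*} {W : Type*} [Group W] {M : CoxeterMatrix B} (cs : CoxeterSystem M W)

/-! ### Coxeter systems: the exchange condition and elements with a prescribed descent set

These facts are used only to show that the elements `x_I` form a basis of the descent algebra. -/

open Classical in
/-- The involution `(t, ε) ↦ (s t s, ε + [t = s])` for the simple reflection `s = s_i`. -/
def flipPerm (i : B) : Equiv.Perm (W × ZMod 2) :=
  Function.Involutive.toPerm
    (fun p => (cs.simple i * p.1 * cs.simple i, p.2 + if p.1 = cs.simple i then 1 else 0)) (by
      rintro ⟨t, ε⟩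
      have h : cs.simple i * t * cs.simple i = cs.simple i ↔ t = cs.simple i := by
        constructor
        · intro h
          have := congrArg (fun u => cs.simple i * u * cs.simple i) h
          simpa [mul_assoc] using this
        · rintro rfl
          simp
      have h2 : (1 : ZMod 2) + 1 = 0 := by decide
      refine Prod.ext ?_ ?_
      · simp [mul_assoc]
      · simp only [h]
        split_ifs <;> simp [add_assoc, h2])

open Classical in
theorem flipPerm_apply (i : B) (t : W) (ε : ZMod 2) :
    cs.flipPerm i (t, ε) =
      (cs.simple i * t * cs.simple i, ε + if t = cs.simple i then 1 else 0) := rfl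

theorem simple_mul_pow_comm (i j : B) (n : ℕ) :
    cs.simple j * (cs.simple i * cs.simple j) ^ n * cs.simple j
      = ((cs.simple i * cs.simple j) ^ n)⁻¹ := by
  induction n with
  | zero => simp
  | succ n ih =>
    rw [pow_succ _ n, mul_inv_rev, ← ih, ← pow_succ _ n, pow_succ']
    simp [mul_assoc]

open Classical in
theorem flipPerm_pow_apply (i j : B) (k : ℕ) (t : W) (ε : ZMod 2) :
    ((cs.flipPerm i * cs.flipPerm j) ^ k) (t, ε) =
      ((cs.simple i * cs.simple j) ^ k * t * ((cs.simple i * cs.simple j) ^ k)⁻¹,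
        ε + ∑ n ∈ Finset.range (2 * k),
          if t = cs.simple j * (cs.simple i * cs.simple j) ^ n then 1 else 0) := by
  induction k with
  | zero => simp
  | succ k ih =>
    set q := cs.simple i * cs.simple j with hq
    have hc := cs.simple_mul_pow_comm i j k
    rw [← hq] at hc
    have hjj : cs.simple j * cs.simple j = 1 := cs.simple_mul_simple_self j
    have hc' : (q ^ k)⁻¹ * cs.simple j = cs.simple j * q ^ k := by
      rw [← hc, mul_assoc, hjj, mul_one]
    have h1 : q ^ k * t * (q ^ k)⁻¹ = cs.simple j ↔ t = cs.simple j * q ^ (2 * k) := by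
      have : cs.simple j * q ^ (2 * k) = (q ^ k)⁻¹ * cs.simple j * q ^ k := by
        rw [hc', two_mul, pow_add, mul_assoc]
      rw [this]
      constructor
      · intro h
        rw [← h]; group
      · rintro rfl
        group
    have h2 : cs.simple j * (q ^ k * t * (q ^ k)⁻¹) * cs.simple j = cs.simple i ↔
        t = cs.simple j * q ^ (2 * k + 1) := by
      have : cs.simple j * q ^ (2 * k + 1) =
          (q ^ k)⁻¹ * (cs.simple j * cs.simple i * cs.simple j) * q ^ k := by
        have e : cs.simple j * cs.simple i * cs.simple j = cs.simple j * q := by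
          rw [hq, mul_assoc]
        rw [e, ← mul_assoc, hc', mul_assoc, mul_assoc, ← pow_succ', ← pow_add]
        congr 2
        ring
      rw [this]
      constructor
      · intro h
        rw [← h]
        simp only [mul_assoc, cs.simple_mul_simple_cancel_left]
        simp
      · rintro rfl
        calc _ = cs.simple j * (cs.simple j * cs.simple i * cs.simple j) * cs.simple j := by group
          _ = _ := by simp [mul_assoc]
    rw [pow_succ', Equiv.Perm.mul_apply, ih, Equiv.Perm.mul_apply, flipPerm_apply, flipPerm_apply]
    refine Prod.ext ?_ ?_
    · simp only [pow_succ' q k, mul_inv_rev]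
      rw [hq]
      simp [mul_assoc]
    · simp only [h1, h2]
      rw [show 2 * (k + 1) = 2 * k + 1 + 1 by ring, Finset.sum_range_succ, Finset.sum_range_succ]
      simp only [add_assoc]

theorem isLiftable_flipPerm : M.IsLiftable cs.flipPerm := by
  classical
  intro i j
  ext1 ⟨t, ε⟩
  have hm : (cs.simple i * cs.simple j) ^ M i j = 1 := cs.simple_mul_simple_pow i j
  have h2 : ∀ x : ZMod 2, x + x = 0 := by decide
  rw [flipPerm_pow_apply, two_mul, Finset.sum_range_add]
  simp [pow_add, hm, h2]

/-- The action of `W` on `W × ℤ/2` that extends the involutions `flipPerm`. -/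
def flipHom : W →* Equiv.Perm (W × ZMod 2) := cs.lift ⟨cs.flipPerm, cs.isLiftable_flipPerm⟩

open Classical in
theorem flipHom_wordProd (ω : List B) (t : W) (ε : ZMod 2) :
    cs.flipHom (cs.wordProd ω) (t, ε) =
      (cs.wordProd ω * t * (cs.wordProd ω)⁻¹, ε + ((cs.rightInvSeq ω).count t : ZMod 2)) := by
  induction ω with
  | nil => simp
  | cons i ω ih =>
    rw [wordProd_cons, map_mul, Equiv.Perm.mul_apply, ih]
    have : cs.flipHom (cs.simple i) = cs.flipPerm i := cs.lift_apply_simple _ _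
    rw [this, flipPerm_apply]
    have h1 : cs.wordProd ω * t * (cs.wordProd ω)⁻¹ = cs.simple i ↔
        (cs.wordProd ω)⁻¹ * cs.simple i * cs.wordProd ω = t := by
      constructor
      · intro h
        rw [← h]; group
      · rintro rfl
        group
    refine Prod.ext ?_ ?_
    · simp [mul_assoc]
    · simp only [h1, rightInvSeq, List.count_cons, beq_iff_eq]
      push_cast
      rw [add_assoc]

/-- The exchange condition. -/
theorem exchange (ω : List B) (i : B)
    (h : cs.IsRightDescent (cs.wordProd ω) i) :
    ∃ j < ω.length, cs.wordProd ω * cs.simple i = cs.wordProd (ω.eraseIdx j) := by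
  classical
  obtain ⟨ω', hω', e⟩ := cs.exists_isReduced (cs.wordProd ω * cs.simple i)
  have e2 : cs.wordProd ω = cs.wordProd (ω' ++ [i]) := by
    rw [wordProd_append, ← e]; simp
  have hnot : cs.simple i ∉ cs.rightInvSeq ω' := by
    intro hm
    have := (cs.isRightInversion_of_mem_rightInvSeq hω' hm).2
    rw [← e] at this
    unfold IsRightDescent at h
    simp at this
    omega
  have hcount : ((cs.rightInvSeq ω).count (cs.simple i) : ZMod 2) = 1 := by
    have a := congrArg Prod.snd (cs.flipHom_wordProd ω (cs.simple i) 0)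
    rw [e2] at a
    rw [wordProd_append, map_mul, Equiv.Perm.mul_apply, wordProd_singleton] at a
    have hs : cs.flipHom (cs.simple i) = cs.flipPerm i := cs.lift_apply_simple _ _
    rw [hs, flipPerm_apply] at a
    have e3 : cs.simple i * cs.simple i * cs.simple i = cs.simple i := by simp
    rw [e3, flipHom_wordProd] at a
    simp [List.count_eq_zero_of_not_mem hnot] at a
    exact a.symm
  have hmem : cs.simple i ∈ cs.rightInvSeq ω := by
    by_contra hc
    rw [List.count_eq_zero_of_not_mem hc] at hcount
    simp at hcount
  obtain ⟨j, hj, hji⟩ := List.mem_iff_getElem.mp hmem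
  refine ⟨j, by simpa using hj, ?_⟩
  rw [← wordProd_mul_getD_rightInvSeq, List.getD_eq_getElem _ 1 hj, hji]

/-! ### Parabolic subgroups, minimal coset representatives -/

/-- The set `S ⊆ W` of simple reflections, as a type. -/
abbrev Gen : Type _ := ↥(Set.range cs.simple)

/-- The parabolic subgroup `W_I` generated by `I ⊆ S`. -/
def parabolic (I : Set cs.Gen) : Subgroup W := Subgroup.closure (Subtype.val '' I)

/-- The set `X_I = {w | ℓ(ws) > ℓ(w) for all s ∈ I}` of minimal coset representatives of
`W / W_I`. -/
def minCosetReps (I : Set cs.Gen) : Set W :=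
  {w | ∀ s ∈ I, cs.length w < cs.length (w * (s : W))}

theorem exists_reduced_of_mem_parabolic (I : Set cs.Gen) {w : W} (hw : w ∈ cs.parabolic I) :
    ∃ ω : List B, cs.IsReduced ω ∧ cs.wordProd ω = w ∧
      ∀ i ∈ ω, (⟨cs.simple i, i, rfl⟩ : cs.Gen) ∈ I := by
  have step : ∀ u : W, ∀ s : cs.Gen, s ∈ I →
      (∃ ω : List B, cs.IsReduced ω ∧ cs.wordProd ω = u ∧
        ∀ i ∈ ω, (⟨cs.simple i, i, rfl⟩ : cs.Gen) ∈ I) →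
      ∃ ω : List B, cs.IsReduced ω ∧ cs.wordProd ω = u * s ∧
        ∀ i ∈ ω, (⟨cs.simple i, i, rfl⟩ : cs.Gen) ∈ I := by
    rintro u ⟨_, i, rfl⟩ hs ⟨ω, hr, rfl, hI⟩
    by_cases hd : cs.IsRightDescent (cs.wordProd ω) i
    · obtain ⟨j, hj, e⟩ := cs.exchange ω i hd
      refine ⟨ω.eraseIdx j, ?_, e.symm, fun k hk => hI k (List.mem_of_mem_eraseIdx hk)⟩
      have h1 := (cs.isRightDescent_iff).mp hd
      have h2 := List.length_eraseIdx_add_one hj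
      unfold IsReduced at hr ⊢
      rw [← e]
      omega
    · refine ⟨ω ++ [i], ?_, by simp [wordProd_append], ?_⟩
      · have h1 := (cs.not_isRightDescent_iff).mp hd
        unfold IsReduced at hr ⊢
        rw [wordProd_append, wordProd_singleton, h1, hr]
        simp
      · intro k hk
        rcases List.mem_append.mp hk with hk | hk
        · exact hI k hk
        · rw [List.mem_singleton] at hk
          subst hk
          exact hs
  unfold parabolic at hw
  induction hw using Subgroup.closure_induction_right with
  | one => exact ⟨[], by simp [IsReduced], by simp, by simp⟩
  | mul_right x hx y hy ih =>
    obtain ⟨s, hs, rfl⟩ := hy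
    exact step x s hs ih
  | mul_inv_cancel x hx y hy ih =>
    obtain ⟨s, hs, rfl⟩ := hy
    have : (s : W)⁻¹ = s := by
      obtain ⟨_, i, rfl⟩ := s
      simp
    rw [this]
    exact step x s hs ih

theorem mem_of_coe_mem_parabolic (I : Set cs.Gen) (s : cs.Gen)
    (hs : (s : W) ∈ cs.parabolic I) : s ∈ I := by
  obtain ⟨_, i, rfl⟩ := s
  obtain ⟨ω, hr, e, hI⟩ := cs.exists_reduced_of_mem_parabolic I hs
  have hl : ω.length = 1 := by
    rw [← hr.eq, e]
    simp
  obtain ⟨k, rfl⟩ := List.length_eq_one_iff.mp hl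
  have := hI k (by simp)
  rw [wordProd_singleton] at e
  simpa only [e] using this

/-- Every set of simple reflections is the descent set of some element. -/
theorem exists_descentSet_eq [Finite W] (J : Set cs.Gen) :
    ∃ w : W, ∀ s : cs.Gen, cs.length w < cs.length (w * (s : W)) ↔ s ∉ J := by
  obtain ⟨u, hu, hmax⟩ := Set.exists_max_image (cs.parabolic J : Set W) cs.length
    (Set.toFinite _) ⟨1, (cs.parabolic J).one_mem⟩
  refine ⟨u, fun s => ⟨fun h hs => ?_, fun hs => ?_⟩⟩
  · have : u * (s : W) ∈ cs.parabolic J :=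
      (cs.parabolic J).mul_mem hu (Subgroup.subset_closure ⟨s, hs, rfl⟩)
    exact absurd (hmax _ this) (not_le.mpr h)
  · by_contra hlt
    apply hs
    obtain ⟨ω, hr, e, hI⟩ := cs.exists_reduced_of_mem_parabolic J hu
    obtain ⟨_, i, rfl⟩ := s
    have hd : cs.IsRightDescent (cs.wordProd ω) i := by
      have := cs.length_mul_simple_ne u i
      unfold IsRightDescent
      rw [e]
      dsimp only at hlt
      omega
    obtain ⟨j, hj, ej⟩ := cs.exchange ω i hd
    apply cs.mem_of_coe_mem_parabolic J
    have h1 : cs.wordProd (ω.eraseIdx j) ∈ cs.parabolic J := by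
      apply Subgroup.list_prod_mem
      intro x hx
      obtain ⟨k, hk, rfl⟩ := List.mem_map.mp hx
      exact Subgroup.subset_closure ⟨_, hI k (List.mem_of_mem_eraseIdx hk), rfl⟩
    rw [← ej, e] at h1
    exact (Subgroup.mul_mem_cancel_left _ hu).mp h1

/-! ### Coxeter classes and Coxeter types -/

/-- `I ∼ J` if `w I w⁻¹ = J` for some `w ∈ W`. -/
def conjSetoid : Setoid (Set cs.Gen) where
  r I J := ∃ w : W, (fun x => w * x * w⁻¹) '' (Subtype.val '' I) = Subtype.val '' J
  iseqv :=
    { refl := fun I => ⟨1, by simp⟩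
      symm := by
        rintro I J ⟨w, h⟩
        refine ⟨w⁻¹, ?_⟩
        rw [← h, Set.image_image]
        simp [mul_assoc]
      trans := by
        rintro I J K ⟨w, h⟩ ⟨v, h'⟩
        refine ⟨v * w, ?_⟩
        rw [← h', ← h, Set.image_image _ _ (Subtype.val '' I)]
        simp [mul_assoc] }

/-- The set `Λ(W)` of Coxeter classes. -/
def CoxeterClass : Type _ := Quotient cs.conjSetoid

/-- The Coxeter class `λ(I)` of `I ⊆ S`. -/
def coxeterClass (I : Set cs.Gen) : cs.CoxeterClass := Quotient.mk cs.conjSetoid I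

/-- A conjugacy class of `W_I` is cuspidal if it does not meet `W_K` for any proper `K ⊂ I`. -/
def IsCuspidalClass (I : Set cs.Gen) (c : ConjClasses (cs.parabolic I)) : Prop :=
  ∀ K : Set cs.Gen, K ⊂ I → ∀ v ∈ c.carrier, (v : W) ∉ cs.parabolic K

/-- `w` is an `I`-element: its conjugacy class `C(w)` in `W` contains a cuspidal conjugacy class
of `W_I`. (The set `C(w) ∩ W_I` is then this one class, since in a finite Coxeter group a cuspidal
class of `W_I` is the intersection with `W_I` of a conjugacy class of `W`.) -/
def IsElementOfType (I : Set cs.Gen) (w : W) : Prop :=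
  ∃ c : ConjClasses (cs.parabolic I), cs.IsCuspidalClass I c ∧ ∀ v ∈ c.carrier, IsConj w (v : W)

/-- The set `C(λ)` of `λ`-elements: the `I`-elements for `I` in the Coxeter class `λ`. -/
def typeSet (l : cs.CoxeterClass) : Set W :=
  {w | ∃ I : Set cs.Gen, cs.coxeterClass I = l ∧ cs.IsElementOfType I w}

/-- The characteristic function `ξ_λ` of `C(λ)`. -/
def typeIndicator (l : cs.CoxeterClass) : W → ℚ := (cs.typeSet l).indicator 1

end CoxeterSystem

/-! ### Characters of a finite group -/

section Characters

variable {G : Type*} [Group G]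

open Classical in
/-- The class function on `G` induced by a class function on the subgroup `H`:
`g ↦ |H|⁻¹ ∑_{x ∈ G, x⁻¹ g x ∈ H} φ(x⁻¹ g x)`. -/
def inducedClassFunction [Fintype G] (H : Subgroup G) (φ : H → ℚ) (g : G) : ℚ :=
  (Nat.card H : ℚ)⁻¹ * ∑ x : G, if h : x⁻¹ * g * x ∈ H then φ ⟨x⁻¹ * g * x, h⟩ else 0

/-- The scalar product `|G|⁻¹ ∑_g f(g) f'(g)` of functions on `G`. -/
def classInner [Fintype G] (f f' : G → ℚ) : ℚ := (Nat.card G : ℚ)⁻¹ * ∑ g : G, f g * f' g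

/-- The linear extension of a function on `G` to the group algebra `ℚG`. -/
def linearExtension [Fintype G] (f : G → ℚ) (x : MonoidAlgebra ℚ G) : ℚ := ∑ g : G, x.coeff g * f g

theorem mulRight_mem_rightIdeal (e : MonoidAlgebra ℚ G) (g : G) :
    ∀ x ∈ LinearMap.range (LinearMap.mulLeft ℚ e),
      LinearMap.mulRight ℚ (MonoidAlgebra.single g 1) x ∈
        LinearMap.range (LinearMap.mulLeft ℚ e) := by
  rintro _ ⟨y, rfl⟩
  exact ⟨y * MonoidAlgebra.single g 1, by simp [mul_assoc]⟩

/-- The character of the action of `G` by right multiplication on the right ideal `e ℚG`. -/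
def rightIdealCharacter (e : MonoidAlgebra ℚ G) (g : G) : ℚ :=
  LinearMap.trace ℚ (LinearMap.range (LinearMap.mulLeft ℚ e))
    ((LinearMap.mulRight ℚ (MonoidAlgebra.single g 1)).restrict (mulRight_mem_rightIdeal e g))

end Characters

/-! ### The Solomon descent algebra and the Solomon homomorphism -/

namespace CoxeterSystem

variable {B : Type*} {W : Type*} [Group W] [Fintype W] {M : CoxeterMatrix B}
  (cs : CoxeterSystem M W)

open Classical in
/-- The element `x_I = ∑_{w ∈ X_I} w` of `ℚW`. -/
def descentElement (I : Set cs.Gen) : MonoidAlgebra ℚ W :=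
  ∑ w : W with w ∈ cs.minCosetReps I, MonoidAlgebra.single w 1

open Classical in
theorem coeff_descentElement (I : Set cs.Gen) (w : W) :
    (cs.descentElement I).coeff w = if w ∈ cs.minCosetReps I then 1 else 0 := by
  simp [descentElement, MonoidAlgebra.coeff_sum, Finsupp.finsetSum_apply, Finsupp.single_apply,
    Finset.sum_ite_eq']

/-- The Solomon descent algebra `ΣW`, the subspace of `ℚW` spanned by the `x_I`, `I ⊆ S`. -/
def descentAlgebra : Submodule ℚ (MonoidAlgebra ℚ W) :=
  Submodule.span ℚ (Set.range cs.descentElement)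

theorem linearIndependent_descentElement : LinearIndependent ℚ cs.descentElement := by
  classical
  have : Fintype (Set cs.Gen) := Fintype.ofFinite _
  rw [Fintype.linearIndependent_iff]
  intro c hc
  have key : ∀ J : Set cs.Gen, ∑ I : Set cs.Gen, (if I ⊆ J then c I else 0) = 0 := by
    intro J
    obtain ⟨w, hw⟩ := cs.exists_descentSet_eq Jᶜ
    have h := congrArg (fun x : MonoidAlgebra ℚ W => x.coeff w) hc
    simp only [MonoidAlgebra.coeff_sum, MonoidAlgebra.coeff_smul, Finsupp.finsetSum_apply,
      Finsupp.smul_apply, coeff_descentElement, smul_eq_mul, mul_ite, mul_one, mul_zero,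
      MonoidAlgebra.coeff_zero, Finsupp.zero_apply] at h
    refine Eq.trans (Finset.sum_congr rfl fun I _ => ?_) h
    have : w ∈ cs.minCosetReps I ↔ I ⊆ J := by
      simp only [minCosetReps, Set.mem_ofPred_eq, hw]
      simp [Set.subset_def]
    simp only [this]
  intro J
  induction J using WellFoundedLT.induction with
  | ind J ih =>
    have h := key J
    rw [Finset.sum_eq_single J] at h
    · simpa using h
    · intro I _ hne
      split_ifs with hs
      · exact ih I (lt_of_le_of_ne hs hne)
      · rfl
    · simp

/-- The basis `(x_I)_{I ⊆ S}` of `ΣW`. -/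
def descentBasis : Module.Basis (Set cs.Gen) ℚ cs.descentAlgebra :=
  Module.Basis.span cs.linearIndependent_descentElement

theorem coe_descentBasis (I : Set cs.Gen) :
    (cs.descentBasis I : MonoidAlgebra ℚ W) = cs.descentElement I :=
  congrArg Subtype.val (Module.Basis.span_apply cs.linearIndependent_descentElement I)

/-- The character `1_{W_I}^W` induced from the trivial character of `W_I`. -/
def parabolicCharacter (I : Set cs.Gen) : W → ℚ := inducedClassFunction (cs.parabolic I) 1

/-- The Solomon homomorphism `Φ`, the linear map on `ΣW` with `Φ(x_I) = 1_{W_I}^W`. -/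
def solomonHom : cs.descentAlgebra →ₗ[ℚ] (W → ℚ) :=
  cs.descentBasis.constr ℚ cs.parabolicCharacter

theorem solomonHom_descentBasis (I : Set cs.Gen) :
    cs.solomonHom (cs.descentBasis I) = cs.parabolicCharacter I :=
  cs.descentBasis.constr_basis ℚ cs.parabolicCharacter I

/-- A family of good idempotents: idempotents `E_λ ∈ ΣW`, `λ ∈ Λ(W)`, with `Φ(E_λ) = ξ_λ`. -/
def IsGoodFamily (E : cs.CoxeterClass → cs.descentAlgebra) : Prop :=
  ∀ l, IsIdempotentElem (E l : MonoidAlgebra ℚ W) ∧ cs.solomonHom (E l) = cs.typeIndicator l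

end CoxeterSystem

end

/-! Both sides of the formula in (2) are values of one pairing. Since `Φ(E_λ) = ξ_λ`, the left side
is `Φ(E_λ)(x_I)`. The value `χ_λ(g)` is the trace of `y ↦ E_λ y g` on `ℚW`, so pairing `χ_λ` with an
inverse-invariant class function `f` gives `f(E_λ)`; the right side is thus `Φ(x_I)(E_λ)`
(`classInner_rightIdealCharacter`). Hence (2) is the symmetry (1) for the pairs `(E_λ, x_I)`, and
(1) implies (2).

For the converse, the `x_I` span `ΣW`, and `ΣW` is the span of the `E_λ` plus `ker Φ`. It remains
that `n ∈ ker Φ` pairs to zero on both sides. On one side `Φ(n) = 0`; on the other `n` is nilpotent,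
so every map `y ↦ n y g` has trace zero and `Φ(y)(n) = 0`.

Two facts carry this. First, `ker Φ` is nil. By Solomon's theorem `Φ` is multiplicative, and it
determines the coefficient at `1` (`sum_solomonHom`). An idempotent of `ker Φ` therefore has
coefficient `0` at `1`, so left multiplication by it has trace `0`, and it vanishes; an algebraic
element `x` with no nonzero idempotent among the multiples `x p(x)` is nilpotent. Second, a good
family exists. The characters `1_{W_I}^W` are triangular in the `ξ_λ`, so `ξ_λ` lies in the image of
`Φ`, and idempotents lift modulo a nil kernel.

Solomon's theorem is derived from projections onto cosets: the projection to `gW_J` followed by that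
to `W_I` is the projection to a coset `uW_K` with `uW_Ku⁻¹ = W_I ∩ gW_Jg⁻¹` (`exists_conjInter`).
Summed over cosets, this expands `x_J x_I`; the same `K` expand the product of the induced
characters. -/

noncomputable section

namespace CoxeterSystem

variable {B : Type*} {W : Type*} [Group W] {M : CoxeterMatrix B} (cs : CoxeterSystem M W)

/-! ### The inversion cocycle -/

/-- The cocycle `η(w, t) ∈ ℤ/2` that detects whether the reflection `t` is a right inversion
of `w`. -/
def inversionCocycle (w t : W) : ZMod 2 := (cs.flipHom w (t, 0)).2

theorem flipHom_apply (w t : W) (ε : ZMod 2) :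
    cs.flipHom w (t, ε) = (w * t * w⁻¹, ε + cs.inversionCocycle w t) := by
  classical
  obtain ⟨ω, rfl⟩ := cs.wordProd_surjective w
  simp [inversionCocycle, flipHom_wordProd]

theorem inversionCocycle_mul (u v t : W) :
    cs.inversionCocycle (u * v) t =
      cs.inversionCocycle v t + cs.inversionCocycle u (v * t * v⁻¹) := by
  have h := cs.flipHom_apply (u * v) t 0
  rw [map_mul, Equiv.Perm.mul_apply, flipHom_apply, flipHom_apply] at h
  have := congrArg Prod.snd h
  simp only [zero_add] at this
  exact this.symm

theorem inversionCocycle_one (t : W) : cs.inversionCocycle 1 t = 0 := by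
  simp [inversionCocycle]

open Classical in
theorem inversionCocycle_simple (i : B) (t : W) :
    cs.inversionCocycle (cs.simple i) t = if t = cs.simple i then 1 else 0 := by
  have hs : cs.flipHom (cs.simple i) = cs.flipPerm i := cs.lift_apply_simple _ _
  simp [inversionCocycle, hs, flipPerm_apply]

theorem inversionCocycle_inv_conj (u t : W) :
    cs.inversionCocycle u⁻¹ (u * t * u⁻¹) = cs.inversionCocycle u t := by
  have h := cs.inversionCocycle_mul u⁻¹ u t
  rw [inv_mul_cancel, inversionCocycle_one] at h
  have h2 : ∀ x y : ZMod 2, 0 = x + y → y = x := by decide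
  exact h2 _ _ h

/-- In `t = u s u⁻¹` the contributions of `u` and `u⁻¹` cancel, and `s` contributes `1`. -/
theorem inversionCocycle_self {t : W} (ht : cs.IsReflection t) :
    cs.inversionCocycle t t = 1 := by
  classical
  obtain ⟨u, i, rfl⟩ := ht
  have e : cs.simple i * u⁻¹ * (u * cs.simple i * u⁻¹) * (cs.simple i * u⁻¹)⁻¹
      = cs.simple i := by simp [mul_assoc]
  have e2 : u⁻¹ * (u * cs.simple i * u⁻¹) * u⁻¹⁻¹ = cs.simple i := by group
  rw [mul_assoc u, inversionCocycle_mul, ← mul_assoc u, e, inversionCocycle_mul, e2,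
    inversionCocycle_inv_conj, inversionCocycle_simple, if_pos rfl]
  have h2 : ∀ x : ZMod 2, x + 1 + x = 1 := by decide
  exact h2 _

theorem length_mul_lt_of_inversionCocycle {w t : W} (h : cs.inversionCocycle w t ≠ 0) :
    cs.length (w * t) < cs.length w := by
  classical
  obtain ⟨ω, hω, rfl⟩ := cs.exists_isReduced w
  have hm : t ∈ cs.rightInvSeq ω := by
    by_contra hc
    apply h
    simp [inversionCocycle, flipHom_wordProd, List.count_eq_zero_of_not_mem hc]
  exact (cs.isRightInversion_of_mem_rightInvSeq hω hm).2

/-- Since `η(t, t) = 1`, exactly one of `w` and `w t` has `t` as an inversion, and that one is the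
longer. -/
theorem inversionCocycle_eq_zero_iff {w t : W} (ht : cs.IsReflection t) :
    cs.inversionCocycle w t = 0 ↔ cs.length w < cs.length (w * t) := by
  constructor
  · intro h
    have h1 : cs.inversionCocycle (w * t) t ≠ 0 := by
      rw [inversionCocycle_mul, inversionCocycle_self cs ht]
      simp [h]
    have := cs.length_mul_lt_of_inversionCocycle h1
    rwa [mul_assoc, ht.mul_self, mul_one] at this
  · intro h
    by_contra hc
    exact absurd (cs.length_mul_lt_of_inversionCocycle hc) (not_lt.mpr h.le)

variable {cs}

theorem Gen.isReflection (s : cs.Gen) : cs.IsReflection (s : W) := by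
  obtain ⟨_, i, rfl⟩ := s
  exact cs.isReflection_simple i

theorem Gen.mul_self (s : cs.Gen) : (s : W) * s = 1 := s.isReflection.mul_self

theorem Gen.inv_eq (s : cs.Gen) : (s : W)⁻¹ = s := s.isReflection.inv

variable (cs)

/-! ### Minimal coset representatives -/

theorem coxeterClass_out (l : cs.CoxeterClass) : cs.coxeterClass (Quotient.out l) = l :=
  Quotient.out_eq l

theorem isElementOfType_iff {I : Set cs.Gen} {w : W} :
    cs.IsElementOfType I w ↔ ∃ v : cs.parabolic I,
      cs.IsCuspidalClass I (ConjClasses.mk v) ∧ IsConj w (v : W) := by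
  constructor
  · rintro ⟨c, hc, h⟩
    obtain ⟨v, rfl⟩ := ConjClasses.exists_rep c
    exact ⟨v, hc, h v ConjClasses.mem_carrier_mk⟩
  · rintro ⟨v, hv, h⟩
    refine ⟨_, hv, fun v' hv' => h.trans ?_⟩
    have h1 : IsConj v v' := (ConjClasses.mk_eq_mk_iff_isConj.mp
      (ConjClasses.mem_carrier_iff_mk_eq.mp hv')).symm
    exact (cs.parabolic I).subtype.map_isConj h1

theorem coe_mem_parabolic {I : Set cs.Gen} {s : cs.Gen} (hs : s ∈ I) :
    (s : W) ∈ cs.parabolic I :=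
  Subgroup.subset_closure ⟨s, hs, rfl⟩

theorem parabolic_mono {I J : Set cs.Gen} (h : I ⊆ J) : cs.parabolic I ≤ cs.parabolic J :=
  Subgroup.closure_mono (Set.image_mono h)

theorem parabolic_univ : cs.parabolic Set.univ = ⊤ := by
  rw [parabolic, Set.image_univ, Subtype.range_coe]
  exact cs.subgroup_closure_range_simple

theorem mem_minCosetReps_iff {I : Set cs.Gen} {w : W} :
    w ∈ cs.minCosetReps I ↔ ∀ s ∈ I, cs.inversionCocycle w (s : W) = 0 :=
  forall₂_congr fun s _ => (cs.inversionCocycle_eq_zero_iff s.isReflection).symm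

theorem exists_inversionCocycle_ne_zero {I : Set cs.Gen} {u : W} (hu : u ∈ cs.parabolic I)
    (h1 : u ≠ 1) : ∃ s ∈ I, cs.inversionCocycle u (s : W) ≠ 0 := by
  obtain ⟨ω, hr, rfl, hI⟩ := cs.exists_reduced_of_mem_parabolic I hu
  rcases List.eq_nil_or_concat ω with rfl | ⟨ω', i, rfl⟩
  · simp at h1
  · refine ⟨⟨cs.simple i, i, rfl⟩, hI i (by simp), fun h => ?_⟩
    rw [cs.inversionCocycle_eq_zero_iff (cs.isReflection_simple i), hr.eq] at h
    simp only [List.concat_eq_append, wordProd_append, wordProd_singleton,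
      simple_mul_simple_cancel_right, List.length_append, List.length_singleton] at h
    have := cs.length_wordProd_le ω'
    omega

theorem exists_mul_mem_minCosetReps [Finite W] (I : Set cs.Gen) (a : W) :
    ∃ u ∈ cs.parabolic I, a * u ∈ cs.minCosetReps I ∧ ∀ t ∈ cs.parabolic I,
      cs.IsReflection t → cs.inversionCocycle (a * u) t = 0 := by
  obtain ⟨u, hu, hmin⟩ := Set.exists_min_image (cs.parabolic I : Set W)
    (fun u => cs.length (a * u)) (Set.toFinite _) ⟨1, (cs.parabolic I).one_mem⟩
  have key : ∀ t ∈ cs.parabolic I,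
      cs.IsReflection t → cs.inversionCocycle (a * u) t = 0 := by
    intro t ht hr
    by_contra hc
    have h1 := cs.length_mul_lt_of_inversionCocycle hc
    have h2 := hmin (u * t) ((cs.parabolic I).mul_mem hu ht)
    rw [← mul_assoc] at h2
    omega
  exact ⟨u, hu, cs.mem_minCosetReps_iff.mpr
    fun s hs => key s (cs.coe_mem_parabolic hs) s.isReflection, key⟩

/-- Upgrades the defining condition of `X_I` from simple reflections to all reflections of `W_I`. A
shortest element `w u` of `w W_I` has no inversions in `W_I`; if `u ≠ 1`, a descent `s ∈ I` of `u⁻¹`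
would be a descent of `w = (w u) u⁻¹`. -/
theorem inversionCocycle_eq_zero_of_mem_minCosetReps [Finite W] {I : Set cs.Gen} {w t : W}
    (hw : w ∈ cs.minCosetReps I) (ht : t ∈ cs.parabolic I) (hr : cs.IsReflection t) :
    cs.inversionCocycle w t = 0 := by
  obtain ⟨u, hu, -, hz⟩ := cs.exists_mul_mem_minCosetReps I w
  suffices u = 1 by subst this; simpa using hz t ht hr
  by_contra h1
  obtain ⟨s, hs, hne⟩ := cs.exists_inversionCocycle_ne_zero ((cs.parabolic I).inv_mem hu)
    (inv_ne_one.mpr h1)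
  have hsI := cs.coe_mem_parabolic hs
  apply hne
  have h := cs.inversionCocycle_mul (w * u) u⁻¹ s
  rw [mul_inv_cancel_right, cs.mem_minCosetReps_iff.mp hw s hs, hz _ _ (s.isReflection.conj u⁻¹)]
    at h
  · simpa using h.symm
  · exact (cs.parabolic I).mul_mem ((cs.parabolic I).mul_mem ((cs.parabolic I).inv_mem hu) hsI)
      (by simpa using hu)

theorem inversionCocycle_mul_of_mem_minCosetReps [Finite W] {I : Set cs.Gen} {w u : W}
    (hw : w ∈ cs.minCosetReps I) (hu : u ∈ cs.parabolic I) {s : cs.Gen} (hs : s ∈ I) :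
    cs.inversionCocycle (w * u) (s : W) = cs.inversionCocycle u (s : W) := by
  rw [inversionCocycle_mul, cs.inversionCocycle_eq_zero_of_mem_minCosetReps hw _
    (s.isReflection.conj u), add_zero]
  exact (cs.parabolic I).mul_mem ((cs.parabolic I).mul_mem hu (cs.coe_mem_parabolic hs))
    ((cs.parabolic I).inv_mem hu)

theorem eq_one_of_mul_mem_minCosetReps [Finite W] {I : Set cs.Gen} {w u : W}
    (hw : w ∈ cs.minCosetReps I) (hu : u ∈ cs.parabolic I) (hwu : w * u ∈ cs.minCosetReps I) :
    u = 1 := by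
  by_contra h1
  obtain ⟨s, hs, hne⟩ := cs.exists_inversionCocycle_ne_zero hu h1
  apply hne
  rw [← cs.inversionCocycle_mul_of_mem_minCosetReps hw hu hs]
  exact cs.mem_minCosetReps_iff.mp hwu s hs

/-- Along a reduced word of `u`, each letter lengthens `w u` exactly when it lengthens `u`, because
the cocycles agree on `I`. -/
theorem length_mul_of_mem_minCosetReps [Finite W] {I : Set cs.Gen} {w u : W}
    (hw : w ∈ cs.minCosetReps I) (hu : u ∈ cs.parabolic I) :
    cs.length (w * u) = cs.length w + cs.length u := by
  obtain ⟨ω, hr, rfl, hI⟩ := cs.exists_reduced_of_mem_parabolic I hu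
  clear hu
  induction ω using List.reverseRecOn with
  | nil => simp
  | append_singleton ω i ih =>
    have hI' : ∀ k ∈ ω, (⟨cs.simple k, k, rfl⟩ : cs.Gen) ∈ I := fun k hk => hI k (by simp [hk])
    have hr' : cs.IsReduced ω := by simpa using hr.take ω.length
    have hi : (⟨cs.simple i, i, rfl⟩ : cs.Gen) ∈ I := hI i (by simp)
    have hmem : cs.wordProd ω ∈ cs.parabolic I := by
      apply Subgroup.list_prod_mem
      intro x hx
      obtain ⟨k, hk, rfl⟩ := List.mem_map.mp hx
      exact cs.coe_mem_parabolic (hI' k hk)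
    have h0 : cs.inversionCocycle (cs.wordProd ω) (cs.simple i) = 0 := by
      rw [cs.inversionCocycle_eq_zero_iff (cs.isReflection_simple i), ← cs.wordProd_singleton i,
        ← wordProd_append, hr.eq, hr'.eq]
      simp
    have h1 := cs.inversionCocycle_mul_of_mem_minCosetReps hw hmem hi
    rw [h0, cs.inversionCocycle_eq_zero_iff (cs.isReflection_simple i)] at h1
    have h2 := cs.length_mul_simple (w * cs.wordProd ω) i
    have h3 := ih hr' hI'
    rw [hr.eq, wordProd_append, wordProd_singleton, ← mul_assoc]
    rw [hr'.eq] at h3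
    simp only [List.length_append, List.length_singleton]
    omega

/-- The minimal representative of the coset `a W_I`. -/
def minRep [Finite W] (I : Set cs.Gen) (a : W) : W :=
  a * (cs.exists_mul_mem_minCosetReps I a).choose

/-- The set `I ∩ d J d⁻¹`. -/
def conjInter (I J : Set cs.Gen) (d : W) : Set cs.Gen :=
  {s | s ∈ I ∧ ∃ r ∈ J, d⁻¹ * (s : W) * d = r}

theorem conj_mem_parabolic_of_mem_conjInter {I J : Set cs.Gen} {d x : W}
    (hx : x ∈ cs.parabolic (cs.conjInter I J d)) : d⁻¹ * x * d ∈ cs.parabolic J := by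
  have h : cs.parabolic (cs.conjInter I J d) ≤
      (cs.parabolic J).comap (MulAut.conj d⁻¹).toMonoidHom := by
    rw [parabolic, Subgroup.closure_le]
    rintro _ ⟨s, ⟨-, r, hr, e⟩, rfl⟩
    have := cs.coe_mem_parabolic hr
    rw [← e] at this
    simpa using this
  simpa using h hx

variable [Finite W]

theorem minRep_mem (I : Set cs.Gen) (a : W) : cs.minRep I a ∈ cs.minCosetReps I :=
  (cs.exists_mul_mem_minCosetReps I a).choose_spec.2.1

theorem inv_mul_minRep_mem (I : Set cs.Gen) (a : W) : a⁻¹ * cs.minRep I a ∈ cs.parabolic I := by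
  rw [minRep, inv_mul_cancel_left]
  exact (cs.exists_mul_mem_minCosetReps I a).choose_spec.1

theorem minRep_eq_iff {I : Set cs.Gen} {a z : W} :
    cs.minRep I a = z ↔ z ∈ cs.minCosetReps I ∧ a⁻¹ * z ∈ cs.parabolic I := by
  constructor
  · rintro rfl
    exact ⟨cs.minRep_mem I a, cs.inv_mul_minRep_mem I a⟩
  · rintro ⟨hz, ha⟩
    have h : z * (z⁻¹ * cs.minRep I a) = cs.minRep I a := by group
    have := cs.eq_one_of_mul_mem_minCosetReps (I := I) (w := z) (u := z⁻¹ * cs.minRep I a) hz ?_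
      (by rw [h]; exact cs.minRep_mem I a)
    · rw [← h, this, mul_one]
    · have e : z⁻¹ * cs.minRep I a = (a⁻¹ * z)⁻¹ * (a⁻¹ * cs.minRep I a) := by group
      rw [e]
      exact (cs.parabolic I).mul_mem ((cs.parabolic I).inv_mem ha) (cs.inv_mul_minRep_mem I a)

/-- The projection of `c` to the coset `a W_I`: its element closest to `c`. -/
def cosetProj (I : Set cs.Gen) (a c : W) : W := c * cs.minRep I (c⁻¹ * a)

theorem cosetProj_eq_iff {I : Set cs.Gen} {a c z : W} :
    cs.cosetProj I a c = z ↔ c⁻¹ * z ∈ cs.minCosetReps I ∧ a⁻¹ * z ∈ cs.parabolic I := by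
  rw [cosetProj, ← eq_inv_mul_iff_mul_eq, minRep_eq_iff]
  simp [mul_assoc]

theorem cosetProj_mul (I : Set cs.Gen) (g a c : W) :
    cs.cosetProj I (g * a) (g * c) = g * cs.cosetProj I a c := by
  simp [cosetProj, mul_assoc]

theorem cosetProj_one (I : Set cs.Gen) (a : W) : cs.cosetProj I a 1 = cs.minRep I a := by
  simp [cosetProj]

/-! ### Double cosets -/

/-- Induction on a word of `y`, in the manner of Deodhar's lemma. If `m = x⁻¹ d y` is minimal in
`W_I m` but `m s` is not minimal in its coset, then `m s = s' m` with `s' ∈ I`, and replacing `x` by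
`x s'` restores `m`. -/
theorem exists_mem_parabolic_conjInter {I J : Set cs.Gen} {d : W} (hdJ : d ∈ cs.minCosetReps J)
    {y : W} (hdI : d⁻¹ ∈ cs.minCosetReps I) (hy : y ∈ cs.parabolic J) :
    ∃ x ∈ cs.parabolic (cs.conjInter I J d), (x⁻¹ * d * y)⁻¹ ∈ cs.minCosetReps I := by
  classical
  have step : ∀ y ∈ cs.parabolic J, ∀ s ∈ J,
      (∃ x ∈ cs.parabolic (cs.conjInter I J d), (x⁻¹ * d * y)⁻¹ ∈ cs.minCosetReps I) →
      ∃ x ∈ cs.parabolic (cs.conjInter I J d),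
        (x⁻¹ * d * (y * (s : W)))⁻¹ ∈ cs.minCosetReps I := by
    rintro y hy s hs ⟨x, hx, hm⟩
    by_cases hc : (x⁻¹ * d * (y * (s : W)))⁻¹ ∈ cs.minCosetReps I
    · exact ⟨x, hx, hc⟩
    · set m := x⁻¹ * d * y with hmdef
      have e1 : (x⁻¹ * d * (y * (s : W)))⁻¹ = (s : W) * m⁻¹ := by
        rw [← mul_assoc, ← hmdef, mul_inv_rev, s.inv_eq]
      rw [e1, mem_minCosetReps_iff] at hc
      push Not at hc
      obtain ⟨s', hs', hne⟩ := hc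
      rw [inversionCocycle_mul, cs.mem_minCosetReps_iff.mp hm s' hs', zero_add, inv_inv] at hne
      have e2 : m⁻¹ * (s' : W) * m = s := by
        obtain ⟨_, i, rfl⟩ := s
        by_contra h
        exact hne (by rw [inversionCocycle_simple, if_neg h])
      have e3 : (s' : W) * m = m * s := by rw [← e2]; group
      have hxd := cs.conj_mem_parabolic_of_mem_conjInter hx
      have hr : d⁻¹ * (s' : W) * d ∈ cs.parabolic J := by
        have : d⁻¹ * (s' : W) * d
            = (d⁻¹ * x * d)⁻¹ * (y * s * y⁻¹) * (d⁻¹ * x * d) := by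
          have : (s' : W) = m * s * m⁻¹ := by rw [← e3]; group
          rw [this, hmdef]; group
        rw [this]
        have hys := (cs.parabolic J).mul_mem ((cs.parabolic J).mul_mem hy (cs.coe_mem_parabolic hs))
          ((cs.parabolic J).inv_mem hy)
        exact (cs.parabolic J).mul_mem ((cs.parabolic J).mul_mem
          ((cs.parabolic J).inv_mem hxd) hys) hxd
      have hK : s' ∈ cs.conjInter I J d := by
        refine ⟨hs', ?_⟩
        -- Lengths add in `d · (d⁻¹ s' d) = s' d`, whose length is at most `ℓ(d) + 1`; hence `d⁻¹ s'
        -- d` is a simple reflection.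
        have hl := cs.length_mul_of_mem_minCosetReps hdJ hr
        have e4 : d * (d⁻¹ * (s' : W) * d) = s' * d := by group
        have h1 : cs.length (s' : W) = 1 := by
          obtain ⟨_, i, rfl⟩ := s'
          simp
        have h2 := cs.length_mul_le (s' : W) d
        rw [e4] at hl
        have h3 : cs.length (d⁻¹ * (s' : W) * d) ≠ 0 := by
          rw [Ne, cs.length_eq_zero_iff]
          intro h
          have : (s' : W) = 1 := by
            have := congrArg (fun z => d * z * d⁻¹) h
            simpa [mul_assoc] using this
          rw [this] at h1
          simp at h1
        obtain ⟨i, hi⟩ := cs.length_eq_one_iff.mp (show cs.length (d⁻¹ * (s' : W) * d) = 1 by omega)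
        refine ⟨⟨cs.simple i, i, rfl⟩, cs.mem_of_coe_mem_parabolic J _ ?_, hi⟩
        rw [hi] at hr
        exact hr
      refine ⟨x * s', (cs.parabolic _).mul_mem hx (cs.coe_mem_parabolic hK), ?_⟩
      have e5 : (x * (s' : W))⁻¹ * d * (y * s) = m := by
        calc (x * (s' : W))⁻¹ * d * (y * s) = (s' : W)⁻¹ * (m * s) := by rw [hmdef]; group
          _ = m := by rw [← e3]; group
      rw [e5]
      exact hm
  unfold parabolic at hy
  induction hy using Subgroup.closure_induction_right with
  | one => exact ⟨1, Subgroup.one_mem _, by simpa using hdI⟩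
  | mul_right x hx y hy ih =>
    obtain ⟨s, hs, rfl⟩ := hy
    exact step x hx s hs ih
  | mul_inv_cancel x hx y hy ih =>
    obtain ⟨s, hs, rfl⟩ := hy
    rw [Gen.inv_eq s]
    exact step x hx s hs ih

/-- Minimal coset representatives are unique, so `x` agrees with the element of `W_K` found above.
-/
theorem mem_parabolic_conjInter {I J : Set cs.Gen} {d x y : W} (hdJ : d ∈ cs.minCosetReps J)
    (hdI : d⁻¹ ∈ cs.minCosetReps I) (hy : y ∈ cs.parabolic J) (hx : x ∈ cs.parabolic I)
    (hm : (x⁻¹ * d * y)⁻¹ ∈ cs.minCosetReps I) : x ∈ cs.parabolic (cs.conjInter I J d) := by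
  obtain ⟨x', hx', hm'⟩ := cs.exists_mem_parabolic_conjInter hdJ hdI hy
  have h := cs.eq_one_of_mul_mem_minCosetReps (u := x⁻¹ * x') hm
    ((cs.parabolic I).mul_mem ((cs.parabolic I).inv_mem hx)
      (cs.parabolic_mono (fun s hs => hs.1) hx')) (by
        convert hm' using 1
        group)
  rwa [inv_mul_eq_one.mp h]

theorem exists_double_coset_rep (I J : Set cs.Gen) (g : W) :
    ∃ u ∈ cs.parabolic I, ∃ v ∈ cs.parabolic J, ∃ d, d ∈ cs.minCosetReps J ∧
      d⁻¹ ∈ cs.minCosetReps I ∧ g = u * d * v := by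
  obtain ⟨d, ⟨u, hu, v, hv, e⟩, hmin⟩ := Set.exists_min_image
    {d : W | ∃ u ∈ cs.parabolic I, ∃ v ∈ cs.parabolic J, g = u * d * v} cs.length
    (Set.toFinite _) ⟨g, 1, Subgroup.one_mem _, 1, Subgroup.one_mem _, by simp⟩
  refine ⟨u, hu, v, hv, d, ?_, ?_, e⟩
  · intro s hs
    have hsJ := cs.coe_mem_parabolic hs
    have h := hmin (d * s) ⟨u, hu, s * v, (cs.parabolic J).mul_mem hsJ hv, by
      simp only [e, mul_assoc]
      rw [← mul_assoc (s : W) s, s.mul_self, one_mul]⟩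
    exact lt_of_le_of_ne h (s.isReflection.length_mul_left_ne d).symm
  · intro s hs
    have hsI := cs.coe_mem_parabolic hs
    have h := hmin (s * d) ⟨u * s, (cs.parabolic I).mul_mem hu hsI, v, hv, by
      simp only [e, mul_assoc]
      rw [← mul_assoc (s : W) s, s.mul_self, one_mul]⟩
    have e2 : cs.length (d⁻¹ * (s : W)) = cs.length ((s : W) * d) := by
      rw [← cs.length_inv, mul_inv_rev, inv_inv, s.inv_eq]
    rw [e2, cs.length_inv]
    exact lt_of_le_of_ne h (s.isReflection.length_mul_right_ne d).symm

/-- Intersections of parabolic subgroups, and composites of projections to cosets of parabolic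
subgroups, are of the same kind. -/
theorem exists_conjInter (I J : Set cs.Gen) (g : W) :
    ∃ u ∈ cs.parabolic I, ∃ d : W,
      (∀ x, x ∈ cs.parabolic I ∧ g⁻¹ * x * g ∈ cs.parabolic J ↔
        u⁻¹ * x * u ∈ cs.parabolic (cs.conjInter I J d)) ∧
      ∀ c, cs.cosetProj I 1 (cs.cosetProj J g c) = cs.cosetProj (cs.conjInter I J d) u c := by
  obtain ⟨u, hu, v, hv, d, hdJ, hdI, rfl⟩ := cs.exists_double_coset_rep I J g
  have hKI : cs.parabolic (cs.conjInter I J d) ≤ cs.parabolic I :=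
    cs.parabolic_mono fun s hs => hs.1
  have conjmem : ∀ (H : Subgroup W) {a b : W}, a ∈ H → b ∈ H → a⁻¹ * b * a ∈ H :=
    fun H a b ha hb => H.mul_mem (H.mul_mem (H.inv_mem ha) hb) ha
  refine ⟨u, hu, d, fun x => ⟨?_, ?_⟩, fun c => ?_⟩
  · rintro ⟨hx, hx'⟩
    refine cs.mem_parabolic_conjInter (y := d⁻¹ * (u⁻¹ * x * u) * d) hdJ hdI ?_
      (conjmem _ hu hx) ?_
    · have := conjmem _ ((cs.parabolic J).inv_mem hv) hx'
      convert this using 1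
      group
    · convert hdI using 1
      group
  · intro hx
    constructor
    · have := conjmem _ ((cs.parabolic I).inv_mem hu) (hKI hx)
      convert this using 1
      group
    · have := conjmem _ hv (cs.conj_mem_parabolic_of_mem_conjInter hx)
      convert this using 1
      group
  · set z := cs.cosetProj J (u * d * v) c with hz
    set x := cs.cosetProj I 1 z with hx
    obtain ⟨hz1, hz2⟩ := cs.cosetProj_eq_iff.mp hz.symm
    obtain ⟨hx1, hx2⟩ := cs.cosetProj_eq_iff.mp hx.symm
    rw [inv_one, one_mul] at hx2
    have hy : d⁻¹ * u⁻¹ * z ∈ cs.parabolic J := by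
      have := (cs.parabolic J).mul_mem hv hz2
      convert this using 1
      group
    have hk : u⁻¹ * x ∈ cs.parabolic (cs.conjInter I J d) := by
      refine cs.mem_parabolic_conjInter hdJ hdI hy
        ((cs.parabolic I).mul_mem ((cs.parabolic I).inv_mem hu) hx2) ?_
      convert hx1 using 1
      group
    refine (cs.cosetProj_eq_iff.mpr ⟨?_, hk⟩).symm
    rw [mem_minCosetReps_iff]
    intro s hs
    -- Splitting at the intermediate projection `z`: the factor `z⁻¹ x` has no descent in `I`, and
    -- `z⁻¹ x` carries `s` to a reflection of `W_J`, which is no inversion of `c⁻¹ z`.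
    have e : c⁻¹ * x = (c⁻¹ * z) * (z⁻¹ * x) := by group
    rw [e, inversionCocycle_mul, cs.mem_minCosetReps_iff.mp hx1 s hs.1, zero_add]
    refine cs.inversionCocycle_eq_zero_of_mem_minCosetReps hz1 ?_ (s.isReflection.conj _)
    have hkk := cs.conj_mem_parabolic_of_mem_conjInter
      (conjmem _ ((cs.parabolic _).inv_mem hk) (cs.coe_mem_parabolic hs))
    have := conjmem _ hy hkk
    convert this using 1
    group

/-- If `W_I` and `W_J` are conjugate in `W`, then so are `I` and `J`. -/
theorem coxeterClass_eq_of_conj {I J : Set cs.Gen} {g : W}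
    (h : ∀ x, x ∈ cs.parabolic I ↔ g⁻¹ * x * g ∈ cs.parabolic J) :
    cs.coxeterClass I = cs.coxeterClass J := by
  -- If `W_I ⊆ g W_J g⁻¹`, the intersection subgroup is all of `W_I`, so `I ∩ d J d⁻¹` contains
  -- every `s ∈ I`. Applied in both directions, this leaves only a comparison of cardinalities.
  have half : ∀ {I J : Set cs.Gen} {g : W},
      (∀ x, x ∈ cs.parabolic I → g⁻¹ * x * g ∈ cs.parabolic J) →
      ∃ d : W, ∀ s ∈ I, ∃ r ∈ J, d⁻¹ * (s : W) * d = r := by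
    intro I J g h
    obtain ⟨u, hu, d, h1, -⟩ := cs.exists_conjInter I J g
    refine ⟨d, fun s hs => ?_⟩
    have hs' := cs.coe_mem_parabolic hs
    have h2 : u * (s : W) * u⁻¹ ∈ cs.parabolic I :=
      (cs.parabolic I).mul_mem ((cs.parabolic I).mul_mem hu hs') ((cs.parabolic I).inv_mem hu)
    have h3 := (h1 _).mp ⟨h2, h _ h2⟩
    have h4 : u⁻¹ * (u * (s : W) * u⁻¹) * u = s := by group
    rw [h4] at h3
    exact (cs.mem_of_coe_mem_parabolic _ s h3).2
  have hsub : ∀ {I J : Set cs.Gen} {d : W}, (∀ s ∈ I, ∃ r ∈ J, d⁻¹ * (s : W) * d = r) →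
      (fun x => d⁻¹ * x * d) '' (Subtype.val '' I) ⊆ Subtype.val '' J := by
    rintro I J d h _ ⟨_, ⟨s, hs, rfl⟩, rfl⟩
    obtain ⟨r, hr, e⟩ := h s hs
    exact ⟨r, hr, e.symm⟩
  have hinj : ∀ d : W, Function.Injective fun x : W => d⁻¹ * x * d := fun d x y hxy => by
    simpa using hxy
  obtain ⟨d, hd⟩ := half fun x => (h x).mp
  obtain ⟨d', hd'⟩ := half (I := J) (J := I) (g := g⁻¹) fun x hx => (h _).mpr (by
    convert hx using 1
    group)
  have c1 := Set.ncard_le_ncard (hsub hd') (Set.toFinite _)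
  rw [Set.ncard_image_of_injective _ (hinj d')] at c1
  refine Quotient.sound ⟨d⁻¹, ?_⟩
  rw [inv_inv]
  refine Set.eq_of_subset_of_ncard_le (hsub hd) ?_ (Set.toFinite _)
  rwa [Set.ncard_image_of_injective _ (hinj d)]

end CoxeterSystem

/-! ### Traces on the group algebra -/

section GroupAlgebra

variable {G : Type*} [Group G] [Fintype G]

theorem linearExtension_add_right (f : G → ℚ) (x y : MonoidAlgebra ℚ G) :
    linearExtension f (x + y) = linearExtension f x + linearExtension f y := by
  simp [linearExtension, add_mul, Finset.sum_add_distrib]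

theorem linearExtension_smul_right (f : G → ℚ) (c : ℚ) (x : MonoidAlgebra ℚ G) :
    linearExtension f (c • x) = c * linearExtension f x := by
  simp [linearExtension, Finset.mul_sum, mul_assoc]

/-- The pairing of functions on `G` with elements of `ℚG`, as a bilinear map. -/
def linearExtensionHom : (G → ℚ) →ₗ[ℚ] MonoidAlgebra ℚ G →ₗ[ℚ] ℚ :=
  LinearMap.mk₂ ℚ linearExtension
    (fun f f' x => by simp [linearExtension, mul_add, Finset.sum_add_distrib])
    (fun c f x => by simp [linearExtension, Finset.mul_sum, mul_left_comm])
    linearExtension_add_right fun c f x => linearExtension_smul_right f c x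

@[simp]
theorem linearExtensionHom_apply (f : G → ℚ) (x : MonoidAlgebra ℚ G) :
    linearExtensionHom f x = linearExtension f x := rfl

theorem trace_mulRight_comp_mulLeft (x : MonoidAlgebra ℚ G) (g : G) :
    LinearMap.trace ℚ (MonoidAlgebra ℚ G)
      (LinearMap.mulRight ℚ (MonoidAlgebra.single g 1) ∘ₗ LinearMap.mulLeft ℚ x) =
      ∑ h : G, x.coeff (h * g⁻¹ * h⁻¹) := by
  classical
  let b : Module.Basis G ℚ (MonoidAlgebra ℚ G) := MonoidAlgebra.basis G ℚ
  have hb : ∀ h, b h = MonoidAlgebra.single h 1 := fun h => by simp [b]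
  rw [LinearMap.trace_eq_matrix_trace ℚ b, Matrix.trace]
  refine Finset.sum_congr rfl fun h _ => ?_
  rw [Matrix.diag_apply, LinearMap.toMatrix_apply, hb]
  change (x * MonoidAlgebra.single h 1 * MonoidAlgebra.single g 1).coeff h = _
  rw [mul_assoc, MonoidAlgebra.single_mul_single, mul_one, MonoidAlgebra.coeff_mul_single_apply]
  simp [mul_assoc]

theorem rightIdealCharacter_eq_sum {e : MonoidAlgebra ℚ G} (he : IsIdempotentElem e) (g : G) :
    rightIdealCharacter e g = ∑ h : G, e.coeff (h * g⁻¹ * h⁻¹) := by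
  rw [← trace_mulRight_comp_mulLeft, rightIdealCharacter]
  have hmem : ∀ x, (LinearMap.mulRight ℚ (MonoidAlgebra.single g 1) ∘ₗ LinearMap.mulLeft ℚ e) x ∈
      LinearMap.range (LinearMap.mulLeft ℚ e) := fun x =>
    mulRight_mem_rightIdeal e g _ (LinearMap.mem_range_self _ x)
  rw [← LinearMap.trace_restrict_eq_of_forall_mem (LinearMap.range (LinearMap.mulLeft ℚ e)) _ hmem]
  congr 1
  ext ⟨x, y, rfl⟩
  simp [← mul_assoc, he.eq]

/-- Stated for arbitrary `x`, since it serves both idempotents (where the trace is a character) and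
nilpotents (where it vanishes). -/
theorem sum_trace_mul_eq {f : G → ℚ} (hconj : ∀ g h, f (h * g * h⁻¹) = f g)
    (hinv : ∀ g, f g⁻¹ = f g) (x : MonoidAlgebra ℚ G) :
    ∑ g : G, (∑ h : G, x.coeff (h * g⁻¹ * h⁻¹)) * f g = Nat.card G * linearExtension f x := by
  have key : ∀ h : G, ∑ g : G, x.coeff (h * g⁻¹ * h⁻¹) * f g = linearExtension f x := by
    intro h
    refine Fintype.sum_equiv ((Equiv.inv G).trans (MulAut.conj h).toEquiv) _ _ fun g => ?_
    simp [hconj, hinv]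
  simp_rw [Finset.sum_mul]
  rw [Finset.sum_comm]
  simp [key]

theorem classInner_rightIdealCharacter {f : G → ℚ} (hconj : ∀ g h, f (h * g * h⁻¹) = f g)
    (hinv : ∀ g, f g⁻¹ = f g) {e : MonoidAlgebra ℚ G} (he : IsIdempotentElem e) :
    classInner (rightIdealCharacter e) f = linearExtension f e := by
  simp_rw [classInner, rightIdealCharacter_eq_sum he]
  rw [sum_trace_mul_eq hconj hinv, inv_mul_cancel_left₀]
  exact_mod_cast Nat.card_pos.ne'

theorem linearExtension_eq_zero_of_isNilpotent {f : G → ℚ}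
    (hconj : ∀ g h, f (h * g * h⁻¹) = f g) (hinv : ∀ g, f g⁻¹ = f g)
    {x : MonoidAlgebra ℚ G} (hx : IsNilpotent x) : linearExtension f x = 0 := by
  have h0 : ∀ g : G, ∑ h : G, x.coeff (h * g⁻¹ * h⁻¹) = 0 := by
    intro g
    rw [← trace_mulRight_comp_mulLeft]
    refine (LinearMap.isNilpotent_trace_of_isNilpotent ?_).eq_zero
    change IsNilpotent (LinearMap.mulRight ℚ (MonoidAlgebra.single g (1 : ℚ)) *
      LinearMap.mulLeft ℚ x)
    refine Commute.isNilpotent_mul_left ?_ ((LinearMap.isNilpotent_mulLeft_iff ℚ x).mpr hx)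
    exact (LinearMap.commute_mulLeft_right _ _).symm
  have h := sum_trace_mul_eq hconj hinv x
  simp only [h0, zero_mul, Finset.sum_const_zero] at h
  exact (mul_eq_zero.mp h.symm).resolve_left (by exact_mod_cast Nat.card_pos.ne')

/-- Left multiplication by `e` has trace `|G|` times the coefficient at `1`, and in characteristic
zero the trace of a projection is its rank. -/
theorem eq_zero_of_isIdempotentElem_of_coeff_one {e : MonoidAlgebra ℚ G}
    (he : IsIdempotentElem e) (h1 : e.coeff 1 = 0) : e = 0 := by
  have ht := trace_mulRight_comp_mulLeft e 1
  simp only [inv_one, mul_one, mul_inv_cancel, h1, Finset.sum_const_zero] at ht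
  rw [← MonoidAlgebra.one_def, LinearMap.mulRight_one, LinearMap.id_comp] at ht
  have h := LinearMap.IsIdempotentElem.eq_zero_of_trace_eq_zero (e := LinearMap.mulLeft ℚ e)
    (by rw [IsIdempotentElem, Module.End.mul_eq_comp, ← LinearMap.mulLeft_mul, he.eq]) ht
  simpa using LinearMap.congr_fun h 1

end GroupAlgebra

-- Fitting's decomposition: with minimal polynomial `X^k q` and `q` prime to `X`, the idempotent
-- projecting to the part where `x` is invertible is a polynomial in `x` divisible by `X`.
open Polynomial in
theorem isNilpotent_of_forall_isIdempotentElem_aeval {K A : Type*} [Field K] [Ring A] [Algebra K A]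
    {x : A} (hx : IsIntegral K x)
    (h : ∀ p : K[X], IsIdempotentElem (aeval x (X * p)) → aeval x (X * p) = 0) :
    IsNilpotent x := by
  obtain ⟨q, hq, hnd⟩ := exists_eq_pow_rootMultiplicity_mul_and_not_dvd (minpoly K x)
    (minpoly.ne_zero hx) 0
  set k := rootMultiplicity 0 (minpoly K x)
  rw [C_0, sub_zero] at hq hnd
  -- The exponent `k + 1` rather than `k` keeps the idempotent a multiple of `X` even when `k = 0`.
  have hcop : IsCoprime (X ^ (k + 1)) q :=
    (IsCoprime.pow_left ((irreducible_X.coprime_iff_not_dvd).mpr hnd))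
  obtain ⟨a, b, hab⟩ := hcop
  have h0 : ∀ r, aeval x (r * (X ^ k * q)) = 0 := fun r => by
    rw [← hq, map_mul, minpoly.aeval, mul_zero]
  have e1 : a * X ^ (k + 1) = X * (X ^ k * a) := by ring
  rw [e1] at hab
  have he : aeval x (X * (X ^ k * a)) = 0 := by
    apply h
    rw [IsIdempotentElem, ← map_mul, ← sub_eq_zero, ← map_sub]
    rw [← neg_eq_zero, ← map_neg, ← h0 (X * a * b)]
    congr 1
    linear_combination (-X * (X ^ k * a)) * hab
  refine ⟨k, ?_⟩
  have h2 := h0 b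
  have e3 : b * (X ^ k * q) = X ^ k - X ^ k * (X * (X ^ k * a)) := by
    linear_combination X ^ k * hab
  rw [e3, map_sub, map_mul _ _ (X * (X ^ k * a)), he, mul_zero, sub_zero, map_pow, aeval_X] at h2
  exact h2

namespace CoxeterSystem

variable {B : Type*} {W : Type*} [Group W] [Fintype W] {M : CoxeterMatrix B}
  (cs : CoxeterSystem M W)

/-! ### Solomon's theorem -/

open Classical in
theorem sum_ite_mem_subgroup {G : Type*} [Group G] [Fintype G] (H : Subgroup G) :
    ∑ x : G, (if x ∈ H then 1 else 0 : ℚ) = Nat.card H := by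
  rw [Finset.sum_boole, Nat.card_eq_fintype_card, Fintype.card_subtype]

theorem card_parabolic_ne_zero (I : Set cs.Gen) : (Nat.card (cs.parabolic I) : ℚ) ≠ 0 := by
  exact_mod_cast Nat.card_pos.ne'

theorem sum_single_minRep (I : Set cs.Gen) :
    ∑ a : W, MonoidAlgebra.single (cs.minRep I a) (1 : ℚ) =
      (Nat.card (cs.parabolic I) : ℚ) • cs.descentElement I := by
  classical
  ext w
  simp only [MonoidAlgebra.coeff_sum, Finsupp.finsetSum_apply, MonoidAlgebra.coeff_single,
    Finsupp.single_apply, MonoidAlgebra.coeff_smul, Finsupp.smul_apply, coeff_descentElement,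
    minRep_eq_iff, smul_eq_mul]
  split_ifs with hw
  · simp only [hw, true_and, mul_one]
    rw [← sum_ite_mem_subgroup]
    exact Fintype.sum_equiv ((Equiv.inv W).trans (Equiv.mulRight w)) _ _ fun a => by simp
  · simp [hw]

open Classical in
theorem card_mul_parabolicCharacter (I : Set cs.Gen) (w : W) :
    Nat.card (cs.parabolic I) * cs.parabolicCharacter I w =
      ∑ x : W, if x⁻¹ * w * x ∈ cs.parabolic I then 1 else 0 := by
  simp only [parabolicCharacter, inducedClassFunction, Pi.one_apply, dite_eq_ite]
  rw [mul_inv_cancel_left₀ (cs.card_parabolic_ne_zero I)]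

open Classical in
theorem parabolicCharacter_eq (I : Set cs.Gen) (w : W) :
    cs.parabolicCharacter I w = (Nat.card (cs.parabolic I) : ℚ)⁻¹ *
      ∑ x : W, if x⁻¹ * w * x ∈ cs.parabolic I then 1 else 0 := by
  rw [← card_mul_parabolicCharacter, inv_mul_cancel_left₀ (cs.card_parabolic_ne_zero I)]

theorem parabolicCharacter_conj (I : Set cs.Gen) (g h : W) :
    cs.parabolicCharacter I (h * g * h⁻¹) = cs.parabolicCharacter I g := by
  classical
  rw [parabolicCharacter_eq, parabolicCharacter_eq]
  congr 1
  exact Fintype.sum_equiv (Equiv.mulLeft h⁻¹) _ _ fun a => by simp [mul_assoc]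

theorem parabolicCharacter_inv (I : Set cs.Gen) (g : W) :
    cs.parabolicCharacter I g⁻¹ = cs.parabolicCharacter I g := by
  classical
  rw [parabolicCharacter_eq, parabolicCharacter_eq]
  congr 1
  refine Finset.sum_congr rfl fun a _ => ?_
  rw [← (cs.parabolic I).inv_mem_iff (x := a⁻¹ * g * a)]
  simp [mul_assoc]

/-- The products `x_J x_I` and `Φ(x_J) Φ(x_I)` have the same expansions in terms of the elements
`x_K` and `Φ(x_K)`. -/
theorem exists_mul_expansion (I J : Set cs.Gen) : ∃ K : W → Set cs.Gen,
    ((Nat.card (cs.parabolic J) * Nat.card (cs.parabolic I) : ℚ) •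
      (cs.descentElement J * cs.descentElement I) =
        ∑ g : W, (Nat.card (cs.parabolic (K g)) : ℚ) • cs.descentElement (K g)) ∧
    ((Nat.card (cs.parabolic J) * Nat.card (cs.parabolic I) : ℚ) •
      (cs.parabolicCharacter J * cs.parabolicCharacter I) =
        ∑ g : W, (Nat.card (cs.parabolic (K g)) : ℚ) • cs.parabolicCharacter (K g)) := by
  classical
  choose u _ d h1 h2 using cs.exists_conjInter I J
  refine ⟨fun g => cs.conjInter I J (d g), ?_, ?_⟩
  · calc _ = (∑ b : W, MonoidAlgebra.single (cs.minRep J b) (1 : ℚ)) *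
          ∑ a : W, MonoidAlgebra.single (cs.minRep I a) (1 : ℚ) := by
          rw [sum_single_minRep, sum_single_minRep, smul_mul_smul_comm]
      _ = ∑ b : W, ∑ a : W,
          MonoidAlgebra.single (cs.cosetProj I a (cs.cosetProj J b 1)) (1 : ℚ) := by
          rw [Finset.sum_mul]
          refine Finset.sum_congr rfl fun b _ => ?_
          rw [Finset.mul_sum]
          refine Fintype.sum_equiv (Equiv.mulLeft (cs.minRep J b)) _ _ fun a => ?_
          simp [cosetProj, MonoidAlgebra.single_mul_single]
      _ = ∑ a : W, ∑ g : W,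
          MonoidAlgebra.single (cs.minRep (cs.conjInter I J (d g)) (a * u g)) (1 : ℚ) := by
          rw [Finset.sum_comm]
          refine Finset.sum_congr rfl fun a _ => ?_
          -- With `b = a g`, translation by `a⁻¹` moves the coset `a W_I` to `W_I` and the base
          -- point `1` to `a⁻¹`.
          refine (Fintype.sum_equiv (Equiv.mulLeft a) _ _ fun g => ?_).symm
          rw [← cosetProj_one, ← mul_inv_cancel a, cosetProj_mul, ← h2, ← cosetProj_mul,
            ← cosetProj_mul, mul_one, Equiv.coe_mulLeft]
      _ = _ := by
          rw [Finset.sum_comm]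
          refine Finset.sum_congr rfl fun g _ => ?_
          rw [← sum_single_minRep]
          exact Fintype.sum_equiv (Equiv.mulRight (u g)) _ _ fun a => rfl
  · ext w
    simp only [Pi.smul_apply, Pi.mul_apply, smul_eq_mul, Finset.sum_apply,
      card_mul_parabolicCharacter]
    calc _ = (∑ b : W, if b⁻¹ * w * b ∈ cs.parabolic J then 1 else 0 : ℚ) *
          ∑ a : W, if a⁻¹ * w * a ∈ cs.parabolic I then 1 else 0 := by
          rw [← card_mul_parabolicCharacter, ← card_mul_parabolicCharacter]
          ring
      -- Mackey's formula by the same substitution `b = a g`: the two conditions become membership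
      -- in one conjugate of `W_K`.
      _ = ∑ a : W, ∑ b : W, if a⁻¹ * w * a ∈ cs.parabolic I ∧ b⁻¹ * w * b ∈ cs.parabolic J
            then 1 else 0 := by
          rw [Finset.sum_mul, Finset.sum_comm]
          refine Finset.sum_congr rfl fun b _ => ?_
          rw [Finset.mul_sum]
          refine Finset.sum_congr rfl fun a _ => ?_
          split_ifs <;> simp_all
      _ = ∑ a : W, ∑ g : W, if (a * u g)⁻¹ * w * (a * u g) ∈
            cs.parabolic (cs.conjInter I J (d g)) then 1 else 0 := by
          refine Finset.sum_congr rfl fun a _ => ?_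
          refine (Fintype.sum_equiv (Equiv.mulLeft a) _ _ fun g => ?_).symm
          have := h1 g (a⁻¹ * w * a)
          simp only [mul_inv_rev, Equiv.coe_mulLeft, ← mul_assoc] at this ⊢
          simp only [this]
      _ = _ := by
          rw [Finset.sum_comm]
          refine Finset.sum_congr rfl fun g _ => ?_
          exact Fintype.sum_equiv (Equiv.mulRight (u g)) _ _ fun a => rfl

/-! ### The descent algebra as an algebra, and multiplicativity of `Φ` -/

theorem descentElement_mem (I : Set cs.Gen) : cs.descentElement I ∈ cs.descentAlgebra :=
  Submodule.subset_span ⟨I, rfl⟩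

theorem solomonHom_descentElement (I : Set cs.Gen) :
    cs.solomonHom ⟨cs.descentElement I, cs.descentElement_mem I⟩ = cs.parabolicCharacter I := by
  rw [← solomonHom_descentBasis]
  congr 1
  exact Subtype.ext (cs.coe_descentBasis I).symm

theorem descentElement_mul_descentElement (J I : Set cs.Gen) :
    ∃ h : cs.descentElement J * cs.descentElement I ∈ cs.descentAlgebra,
      cs.solomonHom ⟨_, h⟩ = cs.parabolicCharacter J * cs.parabolicCharacter I := by
  obtain ⟨K, h1, h2⟩ := cs.exists_mul_expansion I J
  have hc := mul_ne_zero (cs.card_parabolic_ne_zero J) (cs.card_parabolic_ne_zero I)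
  set c : ℚ := Nat.card (cs.parabolic J) * Nat.card (cs.parabolic I)
  have h3 : cs.descentElement J * cs.descentElement I =
      ((c⁻¹ • ∑ g : W, (Nat.card (cs.parabolic (K g)) : ℚ) •
        (⟨_, cs.descentElement_mem (K g)⟩ : cs.descentAlgebra) : cs.descentAlgebra) :
          MonoidAlgebra ℚ W) := by
    simp [← h1, hc]
  refine ⟨h3 ▸ Subtype.prop _, ?_⟩
  have h4 := Subtype.ext (a1 := (⟨_, h3 ▸ Subtype.prop _⟩ : cs.descentAlgebra)) h3
  rw [h4, map_smul, map_sum]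
  simp_rw [map_smul, solomonHom_descentElement]
  rw [← h2, inv_smul_smul₀ hc]

theorem descentElement_univ : cs.descentElement Set.univ = 1 := by
  classical
  ext w
  rw [coeff_descentElement, MonoidAlgebra.one_def, MonoidAlgebra.coeff_single,
    Finsupp.single_apply]
  congr 1
  rw [eq_iff_iff]
  constructor
  · intro hw
    have h1 : w * 1 ∈ cs.minCosetReps Set.univ := by simpa using hw
    have h := cs.eq_one_of_mul_mem_minCosetReps (I := Set.univ) (w := w) (u := w⁻¹) hw
      (by simp [parabolic_univ]) (by
        rw [mul_inv_cancel]
        intro s _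
        rw [one_mul, length_one]
        obtain ⟨_, i, rfl⟩ := s
        simp)
    exact (inv_eq_one.mp h).symm
  · rintro rfl s -
    obtain ⟨_, i, rfl⟩ := s
    simp

/-- The descent algebra as a subalgebra of `ℚW`. -/
def descentSubalgebra : Subalgebra ℚ (MonoidAlgebra ℚ W) :=
  cs.descentAlgebra.toSubalgebra (cs.descentElement_univ ▸ cs.descentElement_mem _) (by
    intro x y hx hy
    have h : cs.descentAlgebra * cs.descentAlgebra ≤ cs.descentAlgebra := by
      conv_lhs => rw [descentAlgebra, Submodule.span_mul_span]
      rw [Submodule.span_le]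
      rintro _ ⟨_, ⟨J, rfl⟩, _, ⟨I, rfl⟩, rfl⟩
      exact (cs.descentElement_mul_descentElement J I).1
    exact h (Submodule.mul_mem_mul hx hy))

/-- The basis `(x_I)` of the subalgebra `ΣW`. -/
def descentSubalgebraBasis : Module.Basis (Set cs.Gen) ℚ cs.descentSubalgebra := cs.descentBasis

/-- The Solomon homomorphism as a linear map on the subalgebra `ΣW`. -/
def solomonLinearMap : cs.descentSubalgebra →ₗ[ℚ] (W → ℚ) := cs.solomonHom

theorem coe_descentSubalgebraBasis (I : Set cs.Gen) :
    (cs.descentSubalgebraBasis I : MonoidAlgebra ℚ W) = cs.descentElement I :=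
  cs.coe_descentBasis I

theorem solomonLinearMap_basis (I : Set cs.Gen) :
    cs.solomonLinearMap (cs.descentSubalgebraBasis I) = cs.parabolicCharacter I :=
  cs.solomonHom_descentBasis I

theorem solomonLinearMap_mul (x y : cs.descentSubalgebra) :
    cs.solomonLinearMap (x * y) = cs.solomonLinearMap x * cs.solomonLinearMap y := by
  have h : (LinearMap.mul ℚ cs.descentSubalgebra).compr₂ cs.solomonLinearMap =
      (LinearMap.mul ℚ (W → ℚ)).compl₁₂ cs.solomonLinearMap cs.solomonLinearMap := by
    refine cs.descentSubalgebraBasis.ext fun J => cs.descentSubalgebraBasis.ext fun I => ?_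
    simp only [LinearMap.compr₂_apply, LinearMap.mul_apply', LinearMap.compl₁₂_apply,
      solomonLinearMap_basis]
    obtain ⟨hm, e⟩ := cs.descentElement_mul_descentElement J I
    rw [← e]
    change cs.solomonHom _ = _
    congr 1
    exact Subtype.ext (by
      change (cs.descentSubalgebraBasis J : MonoidAlgebra ℚ W) * cs.descentSubalgebraBasis I = _
      rw [coe_descentSubalgebraBasis, coe_descentSubalgebraBasis])
  exact LinearMap.congr_fun (LinearMap.congr_fun h x) y

theorem parabolicCharacter_univ : cs.parabolicCharacter Set.univ = 1 := by
  classical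
  ext w
  rw [parabolicCharacter_eq, parabolic_univ]
  simp

theorem solomonLinearMap_one : cs.solomonLinearMap 1 = 1 := by
  rw [← parabolicCharacter_univ, ← solomonLinearMap_basis]
  congr 1
  exact Subtype.ext (by rw [coe_descentSubalgebraBasis, descentElement_univ]; rfl)

/-- The Solomon homomorphism as a homomorphism of algebras. -/
def solomonAlgHom : cs.descentSubalgebra →ₐ[ℚ] (W → ℚ) :=
  AlgHom.ofLinearMap cs.solomonLinearMap cs.solomonLinearMap_one cs.solomonLinearMap_mul

theorem solomonAlgHom_apply (x : cs.descentSubalgebra) :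
    cs.solomonAlgHom x = cs.solomonHom ⟨x, x.2⟩ := rfl

theorem solomonHom_induction {p : cs.descentAlgebra → Prop}
    (basis : ∀ I, p ⟨_, cs.descentElement_mem I⟩) (add : ∀ x y, p x → p y → p (x + y))
    (smul : ∀ (c : ℚ) x, p x → p (c • x)) (zero : p 0) (x : cs.descentAlgebra) : p x := by
  obtain ⟨x, hx⟩ := x
  unfold descentAlgebra at hx
  induction hx using Submodule.span_induction with
  | mem x h => obtain ⟨I, rfl⟩ := h; exact basis I
  | zero => exact zero
  | add x y hx hy h1 h2 => exact add _ _ h1 h2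
  | smul c x hx h => exact smul c _ h

theorem solomonHom_conj (x : cs.descentAlgebra) (g h : W) :
    cs.solomonHom x (h * g * h⁻¹) = cs.solomonHom x g := by
  induction x using cs.solomonHom_induction with
  | basis I => simp [solomonHom_descentElement, parabolicCharacter_conj]
  | add x y hx hy => simp [hx, hy]
  | smul c x hx => simp [hx]
  | zero => simp

theorem solomonHom_inv (x : cs.descentAlgebra) (g : W) :
    cs.solomonHom x g⁻¹ = cs.solomonHom x g := by
  induction x using cs.solomonHom_induction with
  | basis I => simp [solomonHom_descentElement, parabolicCharacter_inv]
  | add x y hx hy => simp [hx, hy]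
  | smul c x hx => simp [hx]
  | zero => simp

/-! ### The coefficient at the identity and the kernel of `Φ` -/

theorem sum_parabolicCharacter (I : Set cs.Gen) :
    ∑ w : W, cs.parabolicCharacter I w = Nat.card W := by
  classical
  simp_rw [parabolicCharacter_eq, ← Finset.mul_sum]
  rw [Finset.sum_comm]
  have h : ∀ x : W, (∑ w : W, if x⁻¹ * w * x ∈ cs.parabolic I then 1 else 0 : ℚ) =
      Nat.card (cs.parabolic I) := by
    intro x
    rw [← sum_ite_mem_subgroup]
    exact Fintype.sum_equiv (MulAut.conj x⁻¹).toEquiv _ _ fun w => by simp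
  simp only [h, Finset.sum_const, nsmul_eq_mul, Finset.card_univ]
  rw [mul_left_comm, inv_mul_cancel₀ (cs.card_parabolic_ne_zero I), mul_one,
    Nat.card_eq_fintype_card]

/-- Both sides are linear and equal `|W|` at each `x_I`: the identity lies in every `X_I`, and
`1_{W_I}^W` contains the trivial character once. -/
theorem sum_solomonHom (x : cs.descentAlgebra) :
    ∑ w : W, cs.solomonHom x w = Nat.card W * (x : MonoidAlgebra ℚ W).coeff 1 := by
  classical
  induction x using cs.solomonHom_induction with
  | basis I =>
    have h1 : (1 : W) ∈ cs.minCosetReps I := by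
      rintro ⟨_, i, rfl⟩ -
      simp
    rw [solomonHom_descentElement, sum_parabolicCharacter]
    simp [coeff_descentElement, h1]
  | add x y hx hy => simp [Finset.sum_add_distrib, hx, hy, mul_add]
  | smul c x hx => simp [← Finset.mul_sum, hx, mul_left_comm]
  | zero => simp

/-- The kernel of the Solomon homomorphism consists of nilpotent elements. -/
theorem isNilpotent_of_solomonAlgHom_eq_zero {x : cs.descentSubalgebra}
    (hx : cs.solomonAlgHom x = 0) : IsNilpotent x := by
  refine isNilpotent_of_forall_isIdempotentElem_aeval (K := ℚ) (Algebra.IsIntegral.isIntegral x)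
    fun p hp => ?_
  set e := Polynomial.aeval x (Polynomial.X * p) with he
  have h0 : cs.solomonAlgHom e = 0 := by simp [he, hx]
  have h1 : (e : MonoidAlgebra ℚ W).coeff 1 = 0 := by
    have h := cs.sum_solomonHom ⟨e, e.2⟩
    rw [← solomonAlgHom_apply, h0] at h
    simpa using h.symm
  exact Subtype.ext (eq_zero_of_isIdempotentElem_of_coeff_one
    (congrArg Subtype.val hp.eq) h1)

theorem linearExtension_solomonHom_eq_zero {x : cs.descentAlgebra} (hx : cs.solomonHom x = 0)
    (y : cs.descentAlgebra) :
    linearExtension (cs.solomonHom y) (x : MonoidAlgebra ℚ W) = 0 :=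
  linearExtension_eq_zero_of_isNilpotent (cs.solomonHom_conj y) (cs.solomonHom_inv y)
    ((cs.isNilpotent_of_solomonAlgHom_eq_zero (x := ⟨x, x.2⟩) hx).map cs.descentSubalgebra.val)

end CoxeterSystem

namespace CoxeterSystem

variable {B : Type*} {W : Type*} [Group W] [Fintype W] {M : CoxeterMatrix B}
  (cs : CoxeterSystem M W)

/-! ### Types of elements -/

/-- The subgroup `W_J ∩ x W_I x⁻¹` has the form `u W_K u⁻¹` with `K ⊆ J` and `u ∈ W_J`. It contains
`v`, so cuspidality forces `K = J`. -/
theorem conj_parabolic_le_of_isCuspidalClass {I J : Set cs.Gen} {v : cs.parabolic J}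
    (hv : cs.IsCuspidalClass J (ConjClasses.mk v)) {x : W}
    (hx : x⁻¹ * (v : W) * x ∈ cs.parabolic I) :
    ∀ y ∈ cs.parabolic J, x⁻¹ * y * x ∈ cs.parabolic I := by
  obtain ⟨u, hu, d, h1, -⟩ := cs.exists_conjInter J I x
  have hK : cs.conjInter J I d = J := by
    by_contra hne
    refine hv _ (lt_of_le_of_ne (fun s hs => hs.1) hne) (⟨u, hu⟩⁻¹ * v * ⟨u, hu⟩) ?_
      ((h1 v).mp ⟨v.2, hx⟩)
    rw [ConjClasses.mem_carrier_iff_mk_eq, ConjClasses.mk_eq_mk_iff_isConj]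
    exact isConj_iff.mpr ⟨⟨u, hu⟩, by group⟩
  intro y hy
  refine ((h1 y).mpr ?_).2
  rw [hK]
  exact (cs.parabolic J).mul_mem ((cs.parabolic J).mul_mem ((cs.parabolic J).inv_mem hu) hy) hu

/-- A minimal `I` for which `W_I` meets the conjugacy class of `w` makes the intersection cuspidal.
-/
theorem exists_isElementOfType (w : W) : ∃ I, cs.IsElementOfType I w := by
  obtain ⟨I, ⟨v, hv, hwv⟩, hmin⟩ := WellFounded.has_min
    (wellFounded_lt : WellFounded fun I J : Set cs.Gen => I < J)
    {I | ∃ v ∈ cs.parabolic I, IsConj w v}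
    ⟨Set.univ, w, by simp [parabolic_univ], IsConj.refl w⟩
  refine ⟨I, cs.isElementOfType_iff.mpr ⟨⟨v, hv⟩, fun K hK v' hv' hK' => ?_, hwv⟩⟩
  refine hmin K ⟨v', hK', hwv.trans ?_⟩ hK
  exact (cs.parabolic I).subtype.map_isConj (ConjClasses.mk_eq_mk_iff_isConj.mp
      (ConjClasses.mem_carrier_iff_mk_eq.mp hv')).symm

open Classical in
/-- The number of cosets `x W_I` such that `W_J` is contained in `x W_I x⁻¹`. -/
def parabolicMark (I J : Set cs.Gen) : ℚ :=
  (Nat.card (cs.parabolic I) : ℚ)⁻¹ *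
    ∑ x : W, if ∀ y ∈ cs.parabolic J, x⁻¹ * y * x ∈ cs.parabolic I then 1 else 0

theorem parabolicCharacter_eq_parabolicMark {I J : Set cs.Gen} {w : W}
    (hw : cs.IsElementOfType J w) : cs.parabolicCharacter I w = cs.parabolicMark I J := by
  classical
  obtain ⟨v, hv, hwv⟩ := cs.isElementOfType_iff.mp hw
  obtain ⟨c, hc⟩ := isConj_iff.mp hwv
  rw [← cs.parabolicCharacter_conj I w c, hc, parabolicCharacter_eq, parabolicMark]
  congr 1
  refine Finset.sum_congr rfl fun x _ => ?_
  congr 1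
  exact propext ⟨cs.conj_parabolic_le_of_isCuspidalClass hv, fun h => h v v.2⟩

theorem parabolicMark_self_ne_zero (I : Set cs.Gen) : cs.parabolicMark I I ≠ 0 := by
  classical
  refine mul_ne_zero (inv_ne_zero (cs.card_parabolic_ne_zero I)) (ne_of_gt ?_)
  refine Finset.sum_pos' (fun x _ => by split_ifs <;> simp) ⟨1, Finset.mem_univ _, ?_⟩
  rw [if_pos (by simp)]
  exact one_pos

theorem exists_of_parabolicMark_ne_zero {I J : Set cs.Gen} (h : cs.parabolicMark I J ≠ 0) :
    ∃ x : W, ∀ y ∈ cs.parabolic J, x⁻¹ * y * x ∈ cs.parabolic I := by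
  classical
  by_contra hc
  push Not at hc
  apply h
  rw [parabolicMark, Finset.sum_eq_zero, mul_zero]
  intro x _
  obtain ⟨y, hy, hxy⟩ := hc x
  exact if_neg fun h' => hxy (h' y hy)

theorem card_parabolic_lt_or_eq {I J : Set cs.Gen} {x : W}
    (h : ∀ y ∈ cs.parabolic J, x⁻¹ * y * x ∈ cs.parabolic I) :
    Nat.card (cs.parabolic J) < Nat.card (cs.parabolic I) ∨
      cs.coxeterClass J = cs.coxeterClass I := by
  have hle : (cs.parabolic J).map (MulAut.conj x⁻¹).toMonoidHom ≤ cs.parabolic I := by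
    rintro _ ⟨y, hy, rfl⟩
    simpa using h y hy
  have hcard : Nat.card ((cs.parabolic J).map (MulAut.conj x⁻¹).toMonoidHom) =
      Nat.card (cs.parabolic J) :=
    Subgroup.card_map_of_injective (MulAut.conj x⁻¹).injective
  by_cases hlt : Nat.card (cs.parabolic J) < Nat.card (cs.parabolic I)
  · exact Or.inl hlt
  · right
    have heq := Subgroup.eq_of_le_of_card_ge hle (by rw [hcard]; exact not_lt.mp hlt)
    refine cs.coxeterClass_eq_of_conj (g := x) fun y => ⟨h y, fun hy => ?_⟩
    rw [← heq] at hy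
    obtain ⟨z, hz, e⟩ := hy
    have : z = y := by simpa using e
    exact this ▸ hz

theorem parabolicMark_congr (I : Set cs.Gen) {J K : Set cs.Gen}
    (h : cs.coxeterClass J = cs.coxeterClass K) :
    cs.parabolicMark I J = cs.parabolicMark I K := by
  classical
  obtain ⟨v, hv⟩ : ∃ w : W, (fun x => w * x * w⁻¹) '' (Subtype.val '' J) = Subtype.val '' K :=
    Quotient.exact h
  have hmap : cs.parabolic K = (cs.parabolic J).map (MulAut.conj v).toMonoidHom := by
    rw [parabolic, parabolic, MonoidHom.map_closure, ← hv]
    rfl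
  rw [parabolicMark, parabolicMark]
  congr 1
  refine Fintype.sum_equiv (Equiv.mulLeft v) _ _ fun x => ?_
  congr 1
  rw [hmap]
  simp only [Subgroup.mem_map, forall_exists_index, and_imp, forall_apply_eq_imp_iff₂]
  simp [mul_assoc]

/-- The nonzero value of `1_{W_I}^W` at `w` is also a mark for `J`, and vice versa. Each of `W_I`,
`W_J` is then conjugate into the other, and comparing orders makes them conjugate. -/
theorem coxeterClass_eq_of_isElementOfType {I J : Set cs.Gen} {w : W}
    (hI : cs.IsElementOfType I w) (hJ : cs.IsElementOfType J w) :
    cs.coxeterClass I = cs.coxeterClass J := by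
  have h1 : cs.parabolicMark I J ≠ 0 := by
    rw [← cs.parabolicCharacter_eq_parabolicMark hJ, cs.parabolicCharacter_eq_parabolicMark hI]
    exact cs.parabolicMark_self_ne_zero I
  have h2 : cs.parabolicMark J I ≠ 0 := by
    rw [← cs.parabolicCharacter_eq_parabolicMark hI, cs.parabolicCharacter_eq_parabolicMark hJ]
    exact cs.parabolicMark_self_ne_zero J
  obtain ⟨x, hx⟩ := cs.exists_of_parabolicMark_ne_zero h1
  obtain ⟨y, hy⟩ := cs.exists_of_parabolicMark_ne_zero h2
  rcases cs.card_parabolic_lt_or_eq hx with h | h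
  · rcases cs.card_parabolic_lt_or_eq hy with h' | h'
    · omega
    · exact h'
  · exact h.symm

/-! ### The functions `ξ_λ` and good idempotents -/

instance : Finite cs.CoxeterClass := inferInstanceAs (Finite (Quotient cs.conjSetoid))

instance : Fintype cs.CoxeterClass := Fintype.ofFinite _

/-- The expansion of `1_{W_I}^W` in terms of the functions `ξ_λ`. -/
theorem parabolicCharacter_eq_sum (I : Set cs.Gen) :
    cs.parabolicCharacter I =
      ∑ l : cs.CoxeterClass, cs.parabolicMark I (Quotient.out l) • cs.typeIndicator l := by
  classical
  ext w
  obtain ⟨J, hJ⟩ := cs.exists_isElementOfType w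
  rw [Finset.sum_apply, Finset.sum_eq_single (cs.coxeterClass J)]
  · have hm : w ∈ cs.typeSet (cs.coxeterClass J) := ⟨J, rfl, hJ⟩
    rw [cs.parabolicCharacter_eq_parabolicMark hJ,
      cs.parabolicMark_congr I (cs.coxeterClass_out _), Pi.smul_apply, typeIndicator,
      Set.indicator_of_mem hm]
    simp
  · intro l _ hl
    have hm : w ∉ cs.typeSet l := by
      rintro ⟨K, rfl, hK⟩
      exact hl (cs.coxeterClass_eq_of_isElementOfType hK hJ)
    simp [typeIndicator, hm]
  · simp

/-- The matrix of marks is triangular for the order of `W_I`, with nonzero diagonal, so induction on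
that order inverts it. -/
theorem typeIndicator_mem_range (l : cs.CoxeterClass) :
    cs.typeIndicator l ∈ LinearMap.range cs.solomonHom := by
  classical
  induction hn : Nat.card (cs.parabolic (Quotient.out l)) using Nat.strong_induction_on
    generalizing l with
  | _ n ih =>
    subst hn
    have h0 := cs.parabolicMark_self_ne_zero (Quotient.out l)
    have h := cs.parabolicCharacter_eq_sum (Quotient.out l)
    rw [← Finset.add_sum_erase _ _ (Finset.mem_univ l), ← sub_eq_iff_eq_add] at h
    rw [← inv_smul_smul₀ h0 (cs.typeIndicator l), ← h]
    refine Submodule.smul_mem _ _ (Submodule.sub_mem _ ⟨_, cs.solomonHom_descentBasis _⟩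
      (Submodule.sum_mem _ fun m hm => ?_))
    by_cases h1 : cs.parabolicMark (Quotient.out l) (Quotient.out m) = 0
    · rw [h1, zero_smul]
      exact Submodule.zero_mem _
    · obtain ⟨x, hx⟩ := cs.exists_of_parabolicMark_ne_zero h1
      rcases cs.card_parabolic_lt_or_eq hx with h2 | h2
      · exact Submodule.smul_mem _ _ (ih _ h2 m rfl)
      · rw [coxeterClass_out, coxeterClass_out] at h2
        exact absurd h2 (Finset.ne_of_mem_erase hm)

/-- Ensures that the second statement of the theorem is not vacuous. No orthogonality is required,
so each `ξ_λ` is lifted separately. -/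
theorem exists_isGoodFamily : ∃ E : cs.CoxeterClass → cs.descentAlgebra, cs.IsGoodFamily E := by
  have h : ∀ l, ∃ e : cs.descentAlgebra, IsIdempotentElem (e : MonoidAlgebra ℚ W) ∧
      cs.solomonHom e = cs.typeIndicator l := by
    intro l
    have hidem : IsIdempotentElem (cs.typeIndicator l) := by
      classical
      ext w
      by_cases hw : w ∈ cs.typeSet l <;> simp [typeIndicator, hw]
    obtain ⟨y, hy⟩ := cs.typeIndicator_mem_range l
    obtain ⟨e, he, h⟩ := exists_isIdempotentElem_eq_of_ker_isNilpotent
      (cs.solomonAlgHom : cs.descentSubalgebra →+* (W → ℚ))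
      (fun x hx => cs.isNilpotent_of_solomonAlgHom_eq_zero hx) (cs.typeIndicator l)
      ⟨⟨y, y.2⟩, hy⟩ hidem
    exact ⟨⟨e, e.2⟩, congrArg Subtype.val he.eq, h⟩
  choose E hE using h
  exact ⟨E, hE⟩

/-- The descent algebra is spanned by the kernel of `Φ` and any good family. -/
theorem IsGoodFamily.exists_eq_add {E : cs.CoxeterClass → cs.descentAlgebra}
    (hE : cs.IsGoodFamily E) (x : cs.descentAlgebra) :
    ∃ (c : cs.CoxeterClass → ℚ) (n : cs.descentAlgebra),
      cs.solomonHom n = 0 ∧ x = ∑ l, c l • E l + n := by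
  have h : ∃ c : cs.CoxeterClass → ℚ, cs.solomonHom x = ∑ l, c l • cs.typeIndicator l := by
    rw [← Submodule.mem_span_range_iff_exists_fun ℚ |>.trans
      (exists_congr fun c => eq_comm)]
    induction x using cs.solomonHom_induction with
    | basis I =>
      rw [solomonHom_descentElement, parabolicCharacter_eq_sum]
      exact Submodule.sum_mem _ fun l _ =>
        Submodule.smul_mem _ _ (Submodule.subset_span ⟨l, rfl⟩)
    | add x y hx hy => rw [map_add]; exact Submodule.add_mem _ hx hy
    | smul c x hx => rw [map_smul]; exact Submodule.smul_mem _ _ hx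
    | zero => rw [map_zero]; exact Submodule.zero_mem _
  obtain ⟨c, hc⟩ := h
  refine ⟨c, x - ∑ l, c l • E l, ?_, (add_sub_cancel _ _).symm⟩
  simp [hc, fun l => (hE l).2]

theorem linearExtension_typeIndicator (l : cs.CoxeterClass) (I : Set cs.Gen) :
    linearExtension (cs.typeIndicator l) (cs.descentElement I) =
      ((cs.typeSet l ∩ cs.minCosetReps I).ncard : ℚ) := by
  classical
  have h : ∀ w, (cs.descentElement I).coeff w * cs.typeIndicator l w =
      if w ∈ cs.typeSet l ∩ cs.minCosetReps I then 1 else 0 := by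
    intro w
    by_cases h1 : w ∈ cs.typeSet l <;> by_cases h2 : w ∈ cs.minCosetReps I <;>
      simp [coeff_descentElement, typeIndicator, h1, h2]
  simp only [linearExtension, h]
  rw [Finset.sum_boole, ← Set.ncard_coe_finset]
  simp

/-- The right hand side of the multiplicity formula is `Φ(x_I)(E_λ)`. -/
theorem IsGoodFamily.classInner_eq {E : cs.CoxeterClass → cs.descentAlgebra}
    (hE : cs.IsGoodFamily E) (I : Set cs.Gen) (l : cs.CoxeterClass) :
    classInner (rightIdealCharacter (E l : MonoidAlgebra ℚ W)) (cs.parabolicCharacter I) =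
      linearExtension (cs.parabolicCharacter I) (E l : MonoidAlgebra ℚ W) :=
  classInner_rightIdealCharacter (cs.parabolicCharacter_conj I) (cs.parabolicCharacter_inv I)
    (hE l).1

end CoxeterSystem

end

/-! ### The equivalence of symmetry and the multiplicity formula -/

theorem mainTheorem3 {B : Type*} {W : Type*} [Group W] [Fintype W] {M : CoxeterMatrix B}
    (cs : CoxeterSystem M W) :
    (∀ x y : cs.descentAlgebra,
      linearExtension (cs.solomonHom x) (y : MonoidAlgebra ℚ W) =
        linearExtension (cs.solomonHom y) (x : MonoidAlgebra ℚ W)) ↔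
    (∀ E : cs.CoxeterClass → cs.descentAlgebra, cs.IsGoodFamily E →
      ∀ (I : Set cs.Gen) (l : cs.CoxeterClass),
        ((cs.typeSet l ∩ cs.minCosetReps I).ncard : ℚ) =
          classInner (rightIdealCharacter (E l : MonoidAlgebra ℚ W))
            (cs.parabolicCharacter I)) := by
  constructor
  · intro h E hE I l
    rw [hE.classInner_eq, ← cs.linearExtension_typeIndicator, ← (hE l).2,
      ← cs.solomonHom_descentElement]
    exact h (E l) ⟨_, cs.descentElement_mem I⟩
  · intro h x y
    obtain ⟨E, hE⟩ := cs.exists_isGoodFamily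
    have hEy : ∀ l, linearExtension (cs.solomonHom (E l)) (y : MonoidAlgebra ℚ W) =
        linearExtension (cs.solomonHom y) (E l : MonoidAlgebra ℚ W) := by
      intro l
      simp only [← linearExtensionHom_apply]
      induction y using cs.solomonHom_induction with
      | basis I =>
        rw [(hE l).2, cs.solomonHom_descentElement, linearExtensionHom_apply,
          linearExtensionHom_apply, cs.linearExtension_typeIndicator, h E hE I l,
          hE.classInner_eq]
      | add y z hy hz => simp only [Submodule.coe_add, map_add, LinearMap.add_apply, hy, hz]
      | smul c y hy => simp only [Submodule.coe_smul, map_smul, LinearMap.smul_apply, hy]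
      | zero => simp only [Submodule.coe_zero, map_zero, LinearMap.zero_apply]
    -- Decomposing `x` alone suffices: `hEy` handles the `E_λ` against arbitrary `y`, and both
    -- pairings with `n` vanish.
    obtain ⟨c, n, hn, rfl⟩ := hE.exists_eq_add cs x
    have h0 := cs.linearExtension_solomonHom_eq_zero hn y
    simp only [← linearExtensionHom_apply] at hEy h0 ⊢
    simp [hn, h0, hEy, -linearExtensionHom_apply]
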